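/- Let $\Delta$ be a thick irreducible spherical building of rank at least $2$, with finite type set $I$. Suppose that $\Delta$ is a compact spherical building, that is, for each $i\in I$ the set $V_i$ of vertices of type $i$ carries a compact Hausdorff topology such that the set $C$ of chambers, viewed as a subset of $\prod_{i\in I}V_i$ (a chamber being the tuple of its vertices), is closed in this product. Give $C$ the subspace topology. Then exactly one of the following holds: $C$ is connected, or $C$ is totally disconnected. Moreover, if $C$ is totally disconnected and infinite, then $C$ is homeomorphic to the Cantor set. -/

import Mathlib

open scoped Pointwise

/-- The standard parabolic subgroup `W_J` of a Coxeter system, generated by the simple reflections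
`s_j` with `j ∈ J`. -/
def CoxeterSystem.parabolic {B W : Type*} [Group W] {M : CoxeterMatrix B}
    (cs : CoxeterSystem M W) (J : Set B) : Subgroup W :=
  Subgroup.closure (cs.simple '' J)

/-- The Coxeter complex of a Coxeter system: its simplices are the cosets `w W_J`, with `w ∈ W` and
`J ⊆ B`. A simplex `a` is a face of the simplex `b` if `b ⊆ a` as cosets (reversed inclusion). The
simplex `w W_J` has type `Jᶜ`; the chambers are the singletons `{w} = w W_∅`, and `W = W_B` is the
empty simplex. -/
abbrev CoxeterSystem.CoxeterComplex {B W : Type*} [Group W] {M : CoxeterMatrix B}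
    (cs : CoxeterSystem M W) : Type _ :=
  {S : Set W // ∃ (w : W) (J : Set B), S = w • (cs.parabolic J : Set W)}

/-- A Coxeter system is irreducible if its generating set does not decompose into two nonempty
subsets which centralize each other. -/
def CoxeterSystem.IsIrreducible {B W : Type*} [Group W] {M : CoxeterMatrix B}
    (cs : CoxeterSystem M W) : Prop :=
  ∀ J : Set B, J.Nonempty → Jᶜ.Nonempty →
    ∃ i ∈ J, ∃ j ∈ Jᶜ, ¬ Commute (cs.simple i) (cs.simple j)

/-- A thick building with Coxeter system `cs` and vertex set `V`, as a simplicial complex (the empty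
simplex included) with a type function on its vertices and a collection of subcomplexes, the
apartments. -/
structure ThickBuilding {B W : Type*} [Group W] {M : CoxeterMatrix B}
    (cs : CoxeterSystem M W) (V : Type*) where
  /-- The simplices. -/
  simplices : Set (Finset V)
  empty_mem : ∅ ∈ simplices
  singleton_mem : ∀ v : V, {v} ∈ simplices
  down_closed : ∀ a b : Finset V, a ⊆ b → b ∈ simplices → a ∈ simplices
  /-- The type of a vertex. The type of a simplex is the set of the types of its vertices. -/
  typ : V → B
  /-- The apartments. -/
  apartments : Set (Set (Finset V))
  apartment_subset : ∀ A ∈ apartments, A ⊆ simplices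
  apartment_down_closed : ∀ A ∈ apartments, ∀ a b : Finset V, a ⊆ b → b ∈ A → a ∈ A
  /-- Every apartment is isomorphic to the Coxeter complex, by a type preserving isomorphism. -/
  apartment_iso : ∀ A ∈ apartments, ∃ e : A ≃ cs.CoxeterComplex,
    (∀ a b : A, a.1 ⊆ b.1 ↔ (e b).1 ⊆ (e a).1) ∧
    ∀ (a : A) (w : W) (J : Set B),
      (e a).1 = w • (cs.parabolic J : Set W) → typ '' (a.1 : Set V) = Jᶜ
  /-- (B1) Any two simplices lie in a common apartment. -/
  exists_apartment : ∀ a ∈ simplices, ∀ b ∈ simplices, ∃ A ∈ apartments, a ∈ A ∧ b ∈ A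
  /-- (B2) If two apartments contain the simplices `a` and `b`, then there is a type preserving
  isomorphism between them that fixes `a` and `b`. -/
  exists_iso : ∀ A ∈ apartments, ∀ A' ∈ apartments, ∀ a b : Finset V,
    a ∈ A → b ∈ A → a ∈ A' → b ∈ A' →
    ∃ e : A ≃ A',
      (∀ x y : A, x.1 ⊆ y.1 ↔ (e x).1 ⊆ (e y).1) ∧
      (∀ x : A, typ '' ((e x).1 : Set V) = typ '' (x.1 : Set V)) ∧
      (∀ x : A, x.1 = a → (e x).1 = a) ∧
      (∀ x : A, x.1 = b → (e x).1 = b)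
  /-- (B3) Thickness: every non-maximal simplex is contained in at least three maximal ones. -/
  thick : ∀ a ∈ simplices, ¬ Maximal (· ∈ simplices) a →
    3 ≤ Set.encard {c : Finset V | Maximal (· ∈ simplices) c ∧ a ⊆ c}

namespace ThickBuilding

/-- A chamber is a maximal simplex. -/
def IsChamber {B W V : Type*} [Group W] {M : CoxeterMatrix B} {cs : CoxeterSystem M W}
    (Δ : ThickBuilding cs V) (c : Finset V) : Prop :=
  Maximal (· ∈ Δ.simplices) c

/-- The set `V_i` of vertices of type `i`. -/
def VertexOfType {B W V : Type*} [Group W] {M : CoxeterMatrix B} {cs : CoxeterSystem M W}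
    (Δ : ThickBuilding cs V) (i : B) : Type _ :=
  {v : V // Δ.typ v = i}

/-- The set of chambers, a chamber being viewed as the tuple of its vertices in `∏ i, V_i`. -/
def chamberSet {B W V : Type*} [Group W] {M : CoxeterMatrix B} {cs : CoxeterSystem M W}
    (Δ : ThickBuilding cs V) : Set (∀ i : B, Δ.VertexOfType i) :=
  {x | ∃ c : Finset V, Δ.IsChamber c ∧ (c : Set V) = Set.range fun i => (x i).1}

/-- A building is spherical if its apartments are finite. -/
def IsSpherical {B W V : Type*} [Group W] {M : CoxeterMatrix B} {cs : CoxeterSystem M W}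
    (Δ : ThickBuilding cs V) : Prop :=
  ∀ A ∈ Δ.apartments, A.Finite

/-- Given topologies on the sets `V_i`, the building is a compact spherical building if it is
spherical, every `V_i` is compact (and Hausdorff), and the set of chambers is closed in the
product `∏ i, V_i`. -/
structure IsCompactSpherical {B W V : Type*} [Group W] {M : CoxeterMatrix B}
    {cs : CoxeterSystem M W} (Δ : ThickBuilding cs V)
    [∀ i : B, TopologicalSpace (Δ.VertexOfType i)] : Prop where
  spherical : Δ.IsSpherical
  compact : ∀ i : B, CompactSpace (Δ.VertexOfType i)
  hausdorff : ∀ i : B, T2Space (Δ.VertexOfType i)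
  isClosed_chamberSet : IsClosed Δ.chamberSet

end ThickBuilding

/-! Everything is read off from the Weyl distance δ on the set C of chambers, with values in the
Coxeter group W, which is finite because apartments are. Two chambers are i-adjacent when their
tuples agree outside the coordinate i, so adjacency is closed, and C is compact. Quantifying a
closed condition over a compact space gives a closed condition, so every bound on the length of δ is
closed. A projection to a panel is the unique solution of such a bound wherever it is defined, hence
it is continuous by the closed graph theorem. Perspectivities between opposite panels are therefore
homeomorphisms, and moving the base point through rank two configurations shows that any two panels
of one type are homeomorphic as pointed spaces (`homogeneous` is the form in which this is used).

Dichotomy. If no panel contains a nontrivial connected subset, then no cell does, by projecting to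
panels inductively. The chambers opposite a given one form an open cell, and these cells cover C, so
C is totally disconnected. Otherwise some panel has a nontrivial connected subset missing a point,
and by homogeneity every panel of that type has one missing its base point. Composing two
projections maps this subset into a panel of a non-commuting type so that its image joins two
prescribed points (`ClosedAdj.exists_isPreconnected_of_ne`). Panels of that type are thus connected;
irreducibility spreads this to all types, and C is connected because adjacency connects it.

Cantor set. If C is infinite, some panel is infinite, and by compactness one of its points is an
accumulation point of a countable subset. Homogeneity gives this at every point of every panel of
that type, and `ClosedAdj.infinite_panel` carries it to the other types. The countable set then
yields a Gδ diagonal on each punctured panel (`ClosedAdj.secondCountableTopology_panel`), so panels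
are second countable, and so is C, which is reached from one chamber in finitely many adjacency
steps. When C is totally disconnected, it is a nonempty perfect second countable Stone space, and
Brouwer's theorem applies. -/

/-! ### Coxeter groups: the exchange condition and longest elements. -/

namespace CoxeterSystem

variable {B W : Type*} [Group W] {M : CoxeterMatrix B} (cs : CoxeterSystem M W)

theorem reverse_alternatingWord_two_mul (i j : B) (m : ℕ) :
    (alternatingWord i j (2 * m)).reverse = alternatingWord j i (2 * m) := by
  apply List.ext_getElem
  · simp
  · intro k h1 h2
    simp only [List.length_reverse, length_alternatingWord] at h1
    rw [List.getElem_reverse, getElem_alternatingWord _ _ _ _ (by simp; omega),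
      getElem_alternatingWord _ _ _ _ h1]
    simp only [length_alternatingWord]
    grind

theorem wordProd_alternatingWord_add_period (i j : B) (k : ℕ) :
    cs.wordProd (alternatingWord i j (2 * (k + M i j) + 1)) =
      cs.wordProd (alternatingWord i j (2 * k + 1)) := by
  rw [prod_alternatingWord_eq_mul_pow, prod_alternatingWord_eq_mul_pow]
  have h1 : (2 * (k + M i j) + 1) / 2 = k + M i j := by omega
  have h2 : (2 * k + 1) / 2 = k := by omega
  rw [h1, h2, pow_add, simple_mul_simple_pow]
  simp

/-- The inversion sequence of a braid relator is periodic with period `M i j`, so each reflection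
occurs in it an even number of times. This is what makes the parity action respect the braid
relations. -/
theorem rightInvSeq_alternatingWord_eq_append (i j : B) :
    ∃ l : List W, cs.rightInvSeq (alternatingWord i j (2 * M i j)) = l ++ l := by
  have hrev : cs.rightInvSeq (alternatingWord i j (2 * M i j)) =
      (cs.leftInvSeq (alternatingWord j i (2 * M i j))).reverse := by
    rw [← rightInvSeq_reverse, reverse_alternatingWord_two_mul]
  set L := cs.leftInvSeq (alternatingWord j i (2 * M i j)) with hL
  have hlen : L.length = 2 * M i j := by simp [hL]
  have hdrop : L.drop (M i j) = L.take (M i j) := by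
    apply List.ext_getElem
    · simp; omega
    · intro k h1 h2
      simp only [List.length_take] at h2
      rw [List.getElem_drop, List.getElem_take]
      simp only [hL]
      rw [getElem_leftInvSeq_alternatingWord cs j i _ _ (by omega),
        getElem_leftInvSeq_alternatingWord cs j i _ _ (by omega), add_comm (M i j) k,
        wordProd_alternatingWord_add_period]
  refine ⟨(L.take (M i j)).reverse, ?_⟩
  rw [hrev, ← List.reverse_append]
  congr 1
  conv_lhs => rw [← List.take_append_drop (M i j) L, hdrop]

open Classical in
/-- The action of a simple reflection on pairs of a group element and a parity. -/
noncomputable def parityStep (i : B) : Function.End (W × ZMod 2) :=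
  fun p => (cs.simple i * p.1 * cs.simple i, p.2 + if p.1 = cs.simple i then 1 else 0)

open Classical in
theorem prod_parityStep (ω : List B) (t : W) (a : ZMod 2) :
    (ω.map cs.parityStep).prod (t, a) =
      (cs.wordProd ω * t * (cs.wordProd ω)⁻¹, a + ((cs.rightInvSeq ω).count t : ℕ)) := by
  induction ω with
  | nil => simp [Function.End.one_def]
  | cons i ω ih =>
    have hmul : ((i :: ω).map cs.parityStep).prod (t, a) =
        cs.parityStep i ((ω.map cs.parityStep).prod (t, a)) := rfl
    rw [hmul, ih]
    have h : (cs.wordProd ω * t * (cs.wordProd ω)⁻¹ = cs.simple i) ↔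
        (cs.wordProd ω)⁻¹ * cs.simple i * cs.wordProd ω = t := by
      constructor
      · intro h; rw [← h]; group
      · intro h; rw [← h]; group
    simp only [parityStep, rightInvSeq, wordProd_cons, mul_inv_rev, inv_simple, mul_assoc,
      List.count_cons, Prod.mk.injEq, true_and]
    simp only [← mul_assoc, h, beq_iff_eq]
    push_cast
    rw [add_assoc]

theorem map_alternatingWord_two_mul_prod {G : Type*} [Monoid G] (f : B → G) (i j : B) (m : ℕ) :
    ((alternatingWord i j (2 * m)).map f).prod = (f i * f j) ^ m := by
  induction m with
  | zero => simp [alternatingWord]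
  | succ m ih =>
    rw [show 2 * (m + 1) = 2 * m + 1 + 1 by ring, alternatingWord_succ, alternatingWord_succ,
      pow_succ, ← ih]
    simp

theorem isLiftable_parityStep : M.IsLiftable cs.parityStep := by
  classical
  intro i j
  rw [← map_alternatingWord_two_mul_prod]
  funext ⟨t, a⟩
  rw [prod_parityStep]
  obtain ⟨l, hl⟩ := cs.rightInvSeq_alternatingWord_eq_append i j
  have h2 : cs.wordProd (alternatingWord i j (2 * M i j)) = 1 := by
    rw [wordProd, map_alternatingWord_two_mul_prod, simple_mul_simple_pow]
  rw [hl, h2, List.count_append]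
  push_cast
  rw [← two_mul, show (2 : ZMod 2) = 0 from rfl]
  simp [Function.End.one_def]

open Classical in
/-- The parity of the number of occurrences of `t` in the right inversion sequence of a word
depends only on the group element represented by the word. -/
theorem count_rightInvSeq_parity {ω ω' : List B} (h : cs.wordProd ω = cs.wordProd ω') (t : W) :
    (((cs.rightInvSeq ω).count t : ℕ) : ZMod 2) = ((cs.rightInvSeq ω').count t : ℕ) := by
  have key : ∀ ω : List B, cs.lift ⟨_, cs.isLiftable_parityStep⟩ (cs.wordProd ω) =
      (ω.map cs.parityStep).prod := by
    intro ω
    rw [wordProd, map_list_prod, List.map_map]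
    congr 1
    apply List.map_congr_left
    intro i _
    simp
  have h1 := congrFun (key ω) (t, 0)
  have h2 := congrFun (key ω') (t, 0)
  rw [h] at h1
  rw [h1, prod_parityStep, prod_parityStep] at h2
  simpa using congrArg Prod.snd h2

/-- The exchange condition. -/
theorem exchange (ω : List B) (i : B)
    (h : cs.length (cs.wordProd ω * cs.simple i) < cs.length (cs.wordProd ω)) :
    ∃ j < ω.length, cs.wordProd ω * cs.simple i = cs.wordProd (ω.eraseIdx j) := by
  classical
  obtain ⟨ω', hr, hω'⟩ := cs.exists_isReduced (cs.wordProd ω * cs.simple i)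
  have hcount' : (cs.rightInvSeq ω').count (cs.simple i) = 0 := by
    rw [List.count_eq_zero]
    intro hmem
    have := (cs.isRightInversion_of_mem_rightInvSeq hr hmem).2
    rw [← hω', simple_mul_simple_cancel_right] at this
    omega
  have hw : cs.wordProd ω = cs.wordProd (ω'.concat i) := by
    rw [wordProd_concat, ← hω', simple_mul_simple_cancel_right]
  have hpar := cs.count_rightInvSeq_parity hw (cs.simple i)
  -- Appending i conjugates the earlier inversions by `s_i` and adds `s_i` itself. Conjugation fixes
  -- `s_i`, which did not occur before, so it now occurs exactly once.
  have hc : (cs.rightInvSeq (ω'.concat i)).count (cs.simple i) = 1 := by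
    rw [rightInvSeq_concat, List.concat_eq_append, List.count_append]
    have hconj : MulAut.conj (cs.simple i) (cs.simple i) = cs.simple i := by simp
    have hmap := List.count_map_of_injective (cs.rightInvSeq ω') (MulAut.conj (cs.simple i))
      (MulEquiv.injective _) (cs.simple i)
    rw [hconj, hcount'] at hmap
    rw [hmap]
    simp
  rw [hc] at hpar
  have hmem : cs.simple i ∈ cs.rightInvSeq ω := by
    by_contra hn
    rw [List.count_eq_zero.mpr hn] at hpar
    exact absurd hpar (by decide)
  obtain ⟨j, hj, hji⟩ := List.mem_iff_getElem.mp hmem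
  refine ⟨j, by simpa using hj, ?_⟩
  rw [← wordProd_mul_getD_rightInvSeq, List.getD_eq_getElem _ _ hj, hji]

/-- Multiplying by a generator from J either lengthens a reduced word by that letter or, by
exchange, deletes a letter, so no letter outside J ever appears. -/
theorem exists_isReduced_of_mem_parabolic {J : Set B} {x : W} (hx : x ∈ cs.parabolic J) :
    ∃ ω : List B, cs.IsReduced ω ∧ (∀ j ∈ ω, j ∈ J) ∧ x = cs.wordProd ω := by
  have step : ∀ x : W, (∃ ω : List B, cs.IsReduced ω ∧ (∀ j ∈ ω, j ∈ J) ∧ x = cs.wordProd ω) →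
      ∀ j ∈ J, ∃ ω : List B, cs.IsReduced ω ∧ (∀ j ∈ ω, j ∈ J) ∧
        x * cs.simple j = cs.wordProd ω := by
    rintro x ⟨ω, hr, hJ, rfl⟩ j hj
    rcases cs.length_mul_simple (cs.wordProd ω) j with h | h
    · refine ⟨ω.concat j, ?_, ?_, by rw [wordProd_concat]⟩
      · rw [IsReduced, wordProd_concat, h, hr.eq]; simp
      · simp only [List.concat_eq_append, List.mem_append, List.mem_singleton]
        rintro k (hk | rfl)
        exacts [hJ k hk, hj]
    · obtain ⟨n, hn, he⟩ := cs.exchange ω j (by omega)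
      refine ⟨ω.eraseIdx n, ?_, fun k hk => hJ k (List.mem_of_mem_eraseIdx hk), he⟩
      rw [IsReduced, ← he]
      have := List.length_eraseIdx_add_one hn
      have := hr.eq
      omega
  refine Subgroup.closure_induction_right (p := fun x _ => ∃ ω : List B, cs.IsReduced ω ∧
    (∀ j ∈ ω, j ∈ J) ∧ x = cs.wordProd ω) ⟨[], by simp [IsReduced], by simp, by simp⟩ ?_ ?_ hx
  · rintro x _ _ ⟨j, hj, rfl⟩ ih
    exact step x ih j hj
  · rintro x _ _ ⟨j, hj, rfl⟩ ih
    rw [inv_simple]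
    exact step x ih j hj

/-- Induction on a reduced word of x: write w as a reduced word τ followed by the part ω of x
already treated, and use the descent of w at the next letter. Exchange deletes a letter either from
τ, which is the claim, or from ω, which would contradict that ω followed by this letter is reduced.
-/
theorem length_add_of_rightDescents {J : Set B} {w : W}
    (hw : ∀ j ∈ J, cs.length (w * cs.simple j) < cs.length w) {x : W} (hx : x ∈ cs.parabolic J) :
    cs.length (w * x⁻¹) + cs.length x = cs.length w := by
  obtain ⟨ω, hr, hJ, rfl⟩ := cs.exists_isReduced_of_mem_parabolic hx
  clear hx
  induction ω using List.reverseRecOn with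
  | nil => simp
  | append_singleton ω i ih =>
    have hr' : cs.IsReduced ω := by
      have := hr.take ω.length
      simpa using this
    have ih := ih hr' fun j hj => hJ j (by simp [hj])
    obtain ⟨τ, hτ, hτw⟩ := cs.exists_isReduced (w * (cs.wordProd ω)⁻¹)
    have hw' : w = cs.wordProd (τ ++ ω) := by
      rw [wordProd_append, ← hτw]; group
    have hdesc := hw i (hJ i (by simp))
    rw [hw'] at hdesc
    obtain ⟨n, hn, he⟩ := cs.exchange _ i hdesc
    have hle := cs.length_le_length_mul_add_right w (cs.wordProd (ω ++ [i]))⁻¹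
    rw [length_inv] at hle
    have hlen : cs.length (cs.wordProd (ω ++ [i])) = ω.length + 1 := by rw [hr.eq]; simp
    have hlen' : cs.length (cs.wordProd ω) = ω.length := hr'.eq
    have hτl : cs.length (w * (cs.wordProd ω)⁻¹) = τ.length := by rw [hτw, hτ.eq]
    rcases lt_or_ge n τ.length with h | h
    · rw [List.eraseIdx_append_of_lt_length h, ← hw', wordProd_append] at he
      have h2 : w * (cs.wordProd (ω ++ [i]))⁻¹ = cs.wordProd (τ.eraseIdx n) := by
        rw [wordProd_append, wordProd_singleton, mul_inv_rev, inv_simple, ← mul_assoc, he]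
        group
      have h3 := cs.length_wordProd_le (τ.eraseIdx n)
      have h4 := List.length_eraseIdx_add_one h
      rw [← h2] at h3
      omega
    · rw [List.eraseIdx_append_of_length_le h, wordProd_append, wordProd_append, mul_assoc] at he
      have h2 := mul_left_cancel he
      rw [← wordProd_singleton, ← wordProd_append] at h2
      have h3 := cs.length_wordProd_le (ω.eraseIdx (n - τ.length))
      have h4 : (ω.eraseIdx (n - τ.length)).length + 1 = ω.length :=
        List.length_eraseIdx_add_one (by simp at hn; omega)
      rw [← h2] at h3
      omega

theorem length_add_of_leftDescents {J : Set B} {w : W}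
    (hw : ∀ j ∈ J, cs.length (cs.simple j * w) < cs.length w) {x : W} (hx : x ∈ cs.parabolic J) :
    cs.length (x * w) + cs.length x = cs.length w := by
  have h := cs.length_add_of_rightDescents (J := J) (w := w⁻¹) (fun j hj => by
    rw [← cs.length_inv, mul_inv_rev, inv_inv, inv_simple, cs.length_inv w]; exact hw j hj) hx
  rw [← cs.length_inv (w⁻¹ * x⁻¹), mul_inv_rev, inv_inv, inv_inv, cs.length_inv w] at h
  exact h

/-- A longest element of a standard parabolic subgroup. -/
structure IsLongest (J : Set B) (w : W) : Prop where
  mem : w ∈ cs.parabolic J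
  left : ∀ x ∈ cs.parabolic J, cs.length (x * w) + cs.length x = cs.length w
  right : ∀ x ∈ cs.parabolic J, cs.length (w * x) + cs.length x = cs.length w

theorem simple_mem_parabolic {J : Set B} {j : B} (hj : j ∈ J) : cs.simple j ∈ cs.parabolic J :=
  Subgroup.subset_closure ⟨j, hj, rfl⟩

theorem exists_isLongest [Finite W] (J : Set B) : ∃ w, cs.IsLongest J w := by
  obtain ⟨w, hw⟩ := Finite.exists_max (fun x : cs.parabolic J => cs.length (x : W))
  refine ⟨w, w.2, fun x hx => ?_, fun x hx => ?_⟩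
  · refine cs.length_add_of_leftDescents (fun j hj => ?_) hx
    have h1 := hw ⟨_, mul_mem (cs.simple_mem_parabolic hj) w.2⟩
    exact lt_of_le_of_ne h1 (cs.length_simple_mul_ne _ _)
  · have h := cs.length_add_of_rightDescents (w := w) (fun j hj => ?_) (inv_mem hx)
    · rwa [inv_inv, length_inv] at h
    · have h1 := hw ⟨_, mul_mem w.2 (cs.simple_mem_parabolic hj)⟩
      exact lt_of_le_of_ne h1 (cs.length_mul_simple_ne _ _)

variable {cs}

theorem IsLongest.mul_self {J : Set B} {w : W} (hw : cs.IsLongest J w) : w * w = 1 := by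
  have := hw.left w hw.mem
  rw [← cs.length_eq_zero_iff]
  omega

/-- Conjugation by a longest element permutes the simple reflections. -/
theorem IsLongest.exists_opposite {J : Set B} {w : W} (hw : cs.IsLongest J w) {j : B}
    (hj : j ∈ J) : ∃ k ∈ J, cs.simple j * w = w * cs.simple k := by
  have hs := cs.simple_mem_parabolic hj
  have hmem : w * (cs.simple j * w) ∈ cs.parabolic J := mul_mem hw.mem (mul_mem hs hw.mem)
  have h1 := hw.left _ hs
  have h2 := hw.right _ (mul_mem hs hw.mem)
  have h3 : cs.length (w * (cs.simple j * w)) = 1 := by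
    rw [cs.length_simple] at h1; omega
  obtain ⟨ω, hr, hJ, hω⟩ := cs.exists_isReduced_of_mem_parabolic hmem
  rw [hω, hr.eq] at h3
  obtain ⟨k, rfl⟩ := List.length_eq_one_iff.mp h3
  refine ⟨k, hJ k (by simp), ?_⟩
  rw [wordProd_singleton] at hω
  rw [← hω, ← mul_assoc, hw.mul_self, one_mul]

theorem IsLongest.eq_of_length_le {w : W} (hw : cs.IsLongest Set.univ w) {x : W}
    (hx : cs.length w ≤ cs.length x) : x = w := by
  have hmem : x⁻¹ ∈ cs.parabolic Set.univ := by
    rw [parabolic, Set.image_univ, subgroup_closure_range_simple]; trivial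
  have h := hw.left _ hmem
  rw [length_inv] at h
  have : x⁻¹ * w = 1 := by rw [← cs.length_eq_zero_iff]; omega
  rw [inv_mul_eq_one] at this
  exact this

variable (cs)

theorem length_simple_mul_simple_of_ne {i j : B}
    (h : cs.simple i ≠ cs.simple j) : cs.length (cs.simple i * cs.simple j) = 2 := by
  rcases cs.length_simple_mul (cs.simple j) i with h1 | h1
  · rw [h1, length_simple]
  · rw [length_simple] at h1
    have : cs.simple i * cs.simple j = 1 := by rw [← cs.length_eq_zero_iff]; omega
    rw [mul_eq_one_iff_eq_inv, inv_simple] at this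
    exact absurd this h

theorem length_simple_mul_simple_mul_simple_of_not_commute {i j : B}
    (h : ¬ Commute (cs.simple i) (cs.simple j)) :
    cs.length (cs.simple i * cs.simple j * cs.simple i) = 3 := by
  have h2 := cs.length_simple_mul_simple_of_ne fun he => h (by rw [he])
  rcases cs.length_mul_simple (cs.simple i * cs.simple j) i with h1 | h1
  · rw [h1, h2]
  · have hw : cs.wordProd [i, j] = cs.simple i * cs.simple j := by simp [wordProd_cons]
    obtain ⟨n, hn, he⟩ := cs.exchange [i, j] i (by rw [hw]; omega)
    rw [hw] at he
    simp only [List.length_cons, List.length_nil] at hn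
    exfalso
    interval_cases n
    · simp only [List.eraseIdx_cons_zero, wordProd_singleton] at he
      have h3 := congrArg (· * cs.simple i) he
      simp only [simple_mul_simple_cancel_right] at h3
      exact h h3
    · simp only [List.eraseIdx_cons_succ, List.eraseIdx_cons_zero, wordProd_singleton] at he
      rw [mul_assoc, mul_eq_left, mul_eq_one_iff_eq_inv, inv_simple] at he
      exact h (by rw [he])

end CoxeterSystem

/-! ### Compact spaces: closed relations, second countability, clopen neighborhoods. -/

section ClosedRelations

open Topology Filter Set TopologicalSpace

variable {X Y : Type*} [TopologicalSpace X] [TopologicalSpace Y]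

/-- Projection along a compact factor is a closed map. With this, geometric constructions with
auxiliary chambers define closed relations. -/
theorem isClosed_setOf_exists [CompactSpace Y] {R : X → Y → Prop}
    (hR : IsClosed {p : X × Y | R p.1 p.2}) : IsClosed {x | ∃ y, R x y} := by
  have h := isClosedMap_fst_of_compactSpace (X := X) (Y := Y) _ hR
  convert h using 1
  ext x
  simp

theorem continuous_of_isClosed_rel [CompactSpace Y] {R : X → Y → Prop}
    (hR : IsClosed {p : X × Y | R p.1 p.2}) {f : X → Y} (hf : ∀ x, R x (f x))
    (huniq : ∀ x y, R x y → y = f x) : Continuous f := by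
  rw [continuous_iff_isClosed]
  intro F hF
  have h : IsClosed {x | ∃ y, y ∈ F ∧ R x y} :=
    isClosed_setOf_exists ((hF.preimage continuous_snd).inter hR)
  convert h using 1
  ext x
  constructor
  · intro hx; exact ⟨f x, hx, hf x⟩
  · rintro ⟨y, hy, hxy⟩
    rw [huniq x y hxy] at hy
    exact hy

theorem IsPreconnected.image_of_isClosed_rel [CompactSpace Y] {R : X → Y → Prop}
    (hR : IsClosed {p : X × Y | R p.1 p.2}) {K : Set X} (hK : IsPreconnected K)
    (hex : ∀ x ∈ K, ∃! y, R x y) : IsPreconnected {y | ∃ x ∈ K, R x y} := by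
  choose f hf huniq using hex
  have hcont : Continuous fun x : K => f x x.2 :=
    continuous_of_isClosed_rel (R := fun (x : K) y => R x y)
      (hR.preimage (continuous_subtype_val.prodMap continuous_id))
      (fun x => hf x x.2) (fun x y h => huniq x x.2 y h)
  have : PreconnectedSpace K := isPreconnected_iff_preconnectedSpace.mp hK
  have h := isPreconnected_range hcont
  convert h using 1
  ext y
  constructor
  · rintro ⟨x, hx, hxy⟩
    exact ⟨⟨x, hx⟩, (huniq x hx y hxy).symm⟩
  · rintro ⟨x, rfl⟩
    exact ⟨x, x.2, hf x x.2⟩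

theorem exists_homeomorph_of_isClosed_rel [CompactSpace X] [CompactSpace Y] {R : X → Y → Prop}
    (hR : IsClosed {p : X × Y | R p.1 p.2}) (h1 : ∀ x, ∃! y, R x y) (h2 : ∀ y, ∃! x, R x y) :
    ∃ e : X ≃ₜ Y, ∀ x, R x (e x) := by
  choose f hf hfu using h1
  choose g hg hgu using h2
  refine ⟨⟨⟨f, g, fun x => (hgu _ x (hf x)).symm, fun y => (hfu _ y (hg y)).symm⟩,
    continuous_of_isClosed_rel hR hf hfu, ?_⟩, hf⟩
  exact continuous_of_isClosed_rel (R := fun y x => R x y) (hR.preimage continuous_swap) hg hgu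

/-- A compact space whose points are separated by a countable family of open sets is second
countable. -/
theorem secondCountableTopology_of_countable_separating [CompactSpace X] {S : Set (Set X)}
    (hS : S.Countable) (hopen : ∀ U ∈ S, IsOpen U)
    (hsep : ∀ x y : X, x ≠ y → ∃ U ∈ S, ∃ V ∈ S, x ∈ U ∧ y ∈ V ∧ Disjoint U V) :
    SecondCountableTopology X := by
  have hle := le_generateFrom hopen
  have hT2 : @T2Space X (generateFrom S) := by
    refine @T2Space.mk X (generateFrom S) fun x y hxy => ?_
    obtain ⟨U, hU, V, hV, hx, hy, hd⟩ := hsep x y hxy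
    exact ⟨U, V, isOpen_generateFrom_of_mem hU, isOpen_generateFrom_of_mem hV, hx, hy, hd⟩
  have hcont : @Continuous X X _ (generateFrom S) id := continuous_id_iff_le.mpr hle
  -- A continuous bijection from a compact space to a Hausdorff space is closed, so the coarser
  -- topology generated by S is the given one.
  have hclosed : @IsClosedMap X X _ (generateFrom S) id :=
    @Continuous.isClosedMap X X _ (generateFrom S) _ hT2 id hcont
  refine ⟨⟨S, hS, le_antisymm hle ?_⟩⟩
  rw [← continuous_id_iff_le, @continuous_iff_isClosed X X (generateFrom S) _]
  intro F hF
  have := hclosed F hF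
  rwa [image_id] at this

/-- A compact Hausdorff image of a compact second countable space is second countable. -/
theorem secondCountableTopology_of_surjective [CompactSpace X] [SecondCountableTopology X]
    [T2Space Y] {f : X → Y} (hf : Continuous f) (hs : Function.Surjective f) :
    SecondCountableTopology Y := by
  have : CompactSpace Y := hs.compactSpace hf
  let b := countableBasis X
  -- For a union O of finitely many basic sets, this is the set of points whose whole fiber lies in
  -- O. It is open because f is closed, and fibers are compact, so finite unions suffice.
  let S : Set (Set Y) := (fun F : Set (Set X) => (f '' (⋃₀ F)ᶜ)ᶜ) '' {F | F.Finite ∧ F ⊆ b}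
  have hSc : S.Countable := (countable_ofPred_finite_subset (countable_countableBasis X)).image _
  refine secondCountableTopology_of_countable_separating hSc ?_ ?_
  · rintro _ ⟨F, ⟨-, hF⟩, rfl⟩
    refine (hf.isClosedMap _ ?_).isOpen_compl
    exact (isOpen_sUnion fun U hU => isOpen_of_mem_countableBasis (hF hU)).isClosed_compl
  · have key : ∀ (y : Y) (N : Set Y), IsOpen N → y ∈ N → ∃ U ∈ S, y ∈ U ∧ U ⊆ N := by
      intro y N hN hy
      have hcomp : IsCompact (f ⁻¹' {y}) := (isClosed_singleton.preimage hf).isCompact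
      have hsub : f ⁻¹' {y} ⊆ f ⁻¹' N := preimage_mono (by simpa using hy)
      have hcov : f ⁻¹' {y} ⊆ ⋃₀ {U | U ∈ b ∧ U ⊆ f ⁻¹' N} := by
        intro x hx
        obtain ⟨U, hU, hxU, hUN⟩ := (isBasis_countableBasis X).exists_subset_of_mem_open
          (hsub hx) (hN.preimage hf)
        exact ⟨U, ⟨hU, hUN⟩, hxU⟩
      obtain ⟨T, hT, hTf, hTc⟩ := hcomp.elim_finite_subcover_image
        (b := {U | U ∈ b ∧ U ⊆ f ⁻¹' N}) (c := id)
        (fun U hU => isOpen_of_mem_countableBasis hU.1) (by rwa [sUnion_eq_biUnion] at hcov)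
      simp only [id, ← sUnion_eq_biUnion] at hTc
      refine ⟨_, ⟨T, ⟨hTf, fun U hU => (hT hU).1⟩, rfl⟩, ?_, ?_⟩
      · rintro ⟨x, hx, hxy⟩
        exact hx (hTc hxy)
      · intro z hz
        obtain ⟨x, rfl⟩ := hs z
        by_contra hn
        refine hz ⟨x, ?_, rfl⟩
        rintro ⟨U, hU, hxU⟩
        exact hn ((hT hU).2 hxU)
    intro x y hxy
    obtain ⟨N, N', hN, hN', hx, hy, hd⟩ := t2_separation hxy
    obtain ⟨U, hU, hxU, hUN⟩ := key x N hN hx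
    obtain ⟨V, hV, hyV, hVN⟩ := key y N' hN' hy
    exact ⟨U, hU, V, hV, hxU, hyV, hd.mono hUN hVN⟩

/-- A compact Hausdorff space with a `Gδ` diagonal is second countable. -/
theorem secondCountableTopology_of_diagonal [CompactSpace X] [T2Space X] {S : Set (Set (X × X))}
    (hS : S.Countable) (hopen : ∀ U ∈ S, IsOpen U) (hdiag : ∀ U ∈ S, ∀ x, (x, x) ∈ U)
    (hsep : ∀ x y : X, x ≠ y → ∃ U ∈ S, (x, y) ∉ U) : SecondCountableTopology X := by
  have key : ∀ U ∈ S, ∃ F : Set (Set X), F.Finite ∧ (∀ O ∈ F, IsOpen O ∧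
      closure O ×ˢ closure O ⊆ U) ∧ ⋃₀ F = univ := by
    intro U hU
    have hloc : ∀ x, ∃ O : Set X, IsOpen O ∧ x ∈ O ∧ closure O ×ˢ closure O ⊆ U := by
      intro x
      have hn : U ∈ 𝓝 (x, x) := (hopen U hU).mem_nhds (hdiag U hU x)
      rw [nhds_prod_eq, mem_prod_same_iff] at hn
      obtain ⟨N, hN, hNU⟩ := hn
      obtain ⟨F, hF, hFc, hFN⟩ := exists_mem_nhds_isClosed_subset hN
      refine ⟨interior F, isOpen_interior, mem_interior_iff_mem_nhds.mpr hF, ?_⟩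
      have : closure (interior F) ⊆ N := (closure_minimal interior_subset hFc).trans hFN
      exact (prod_mono this this).trans hNU
    choose O hO hxO hOU using hloc
    obtain ⟨t, ht⟩ := isCompact_univ.elim_finite_subcover O hO
      (fun x _ => mem_iUnion.mpr ⟨x, hxO x⟩)
    refine ⟨O '' t, t.finite_toSet.image _, ?_, ?_⟩
    · rintro _ ⟨x, -, rfl⟩; exact ⟨hO x, hOU x⟩
    · rw [sUnion_image]; exact univ_subset_iff.mp (by simpa using ht)
  choose! F hFf hF hFc using key
  let T : Set (Set X) := ⋃ U ∈ S, F U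
  have hT : T.Countable := hS.biUnion fun U hU => (hFf U hU).countable
  refine secondCountableTopology_of_countable_separating
    (hT.union (hT.image fun O => (closure O)ᶜ)) ?_ ?_
  · rintro O (hO | ⟨O, hO, rfl⟩)
    · obtain ⟨U, hU, hOU⟩ := mem_iUnion₂.mp hO
      exact (hF U hU O hOU).1
    · exact isClosed_closure.isOpen_compl
  · intro x y hxy
    obtain ⟨U, hU, hn⟩ := hsep x y hxy
    obtain ⟨O, hO, hxO⟩ : x ∈ ⋃₀ F U := by rw [hFc U hU]; trivial
    have hOT : O ∈ T := mem_iUnion₂.mpr ⟨U, hU, hO⟩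
    refine ⟨O, Or.inl hOT, _, Or.inr ⟨O, hOT, rfl⟩, hxO, ?_, ?_⟩
    · exact fun hy => hn ((hF U hU O hO).2 ⟨subset_closure hxO, hy⟩)
    · exact disjoint_compl_right.mono_left subset_closure

/-- A compact Hausdorff space is second countable if, for two distinct points `c`, the diagonal of
the complement of `c` is a `Gδ`. -/
theorem secondCountableTopology_of_punctured_diagonal [CompactSpace X] [T2Space X] {c d : X}
    (hcd : c ≠ d)
    (h : ∀ c : X, ∃ S : Set (Set (X × X)), S.Countable ∧ (∀ U ∈ S, IsOpen U) ∧
      (∀ U ∈ S, ∀ x, x ≠ c → (x, x) ∈ U) ∧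
      ∀ x y : X, x ≠ c → y ≠ c → x ≠ y → ∃ U ∈ S, (x, y) ∉ U) :
    SecondCountableTopology X := by
  obtain ⟨N, N', hN, hN', hc, hd, hdis⟩ := t2_separation hcd
  -- E is an open neighborhood of the diagonal in which c is related only to points of N.
  have hsub : ∀ (c : X) (N : Set X), IsOpen N → c ∈ N → ∃ E : Set (X × X), IsOpen E ∧
      (∀ x, (x, x) ∈ E) ∧ (∀ x, (c, x) ∈ E → x ∈ N) ∧ ∀ x, (x, c) ∈ E → x ∈ N := by
    intro c N hN hc
    obtain ⟨F, hF, hFc, hFN⟩ := exists_mem_nhds_isClosed_subset (hN.mem_nhds hc)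
    have hcF := mem_of_mem_nhds hF
    refine ⟨N ×ˢ N ∪ Fᶜ ×ˢ Fᶜ, (hN.prod hN).union (hFc.isOpen_compl.prod hFc.isOpen_compl),
      fun x => ?_, ?_, ?_⟩
    · by_cases hx : x ∈ F
      · exact Or.inl ⟨hFN hx, hFN hx⟩
      · exact Or.inr ⟨hx, hx⟩
    · rintro x (hx | hx)
      · exact hx.2
      · exact absurd hcF hx.1
    · rintro x (hx | hx)
      · exact hx.1
      · exact absurd hcF hx.2
  obtain ⟨E, hE, hEd, hE1, hE2⟩ := hsub c N hN hc
  obtain ⟨E', hE', hEd', hE1', hE2'⟩ := hsub d N' hN' hd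
  obtain ⟨S, hS, hSo, hSd, hSs⟩ := h c
  obtain ⟨S', hS', hSo', hSd', hSs'⟩ := h d
  -- Enlarging by `N ×ˢ N` repairs the diagonal at c but loses pairs inside N; those are separated
  -- by the family for d, since N is disjoint from N'. Pairs involving c itself are handled by E.
  refine secondCountableTopology_of_diagonal
    (S := {E, E'} ∪ ((fun U => U ∪ N ×ˢ N) '' S ∪ (fun U => U ∪ N' ×ˢ N') '' S')) ?_ ?_ ?_ ?_
  · exact (countable_insert.mpr (countable_singleton _)).union ((hS.image _).union (hS'.image _))
  · rintro _ ((rfl | rfl) | ⟨U, hU, rfl⟩ | ⟨U, hU, rfl⟩)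
    exacts [hE, hE', (hSo U hU).union (hN.prod hN), (hSo' U hU).union (hN'.prod hN')]
  · rintro _ ((rfl | rfl) | ⟨U, hU, rfl⟩ | ⟨U, hU, rfl⟩) x
    · exact hEd x
    · exact hEd' x
    · by_cases hx : x = c
      · exact Or.inr (by rw [hx]; exact ⟨hc, hc⟩)
      · exact Or.inl (hSd U hU x hx)
    · by_cases hx : x = d
      · exact Or.inr (by rw [hx]; exact ⟨hd, hd⟩)
      · exact Or.inl (hSd' U hU x hx)
  · intro x y hxy
    by_contra! hcon
    have hE0 := hcon E (Or.inl (Or.inl rfl))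
    have hE0' := hcon E' (Or.inl (Or.inr rfl))
    have hdis' : ∀ z, z ∈ N → z ∉ N' := fun z h => Set.disjoint_left.mp hdis h
    have hNN : ¬ (x ∈ N ∧ y ∈ N) := by
      rintro ⟨hx, hy⟩
      obtain ⟨U, hU, hn⟩ := hSs' x y (fun h => hdis' x hx (h ▸ hd)) (fun h => hdis' y hy (h ▸ hd)) hxy
      rcases hcon _ (Or.inr (Or.inr ⟨U, hU, rfl⟩)) with h | h
      · exact hn h
      · exact hdis' x hx h.1
    have hxc : x ≠ c := by
      rintro rfl
      exact hNN ⟨hc, hE1 y hE0⟩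
    have hyc : y ≠ c := by
      rintro rfl
      exact hNN ⟨hE2 x hE0, hc⟩
    obtain ⟨U, hU, hn⟩ := hSs x y hxc hyc hxy
    rcases hcon _ (Or.inr (Or.inl ⟨U, hU, rfl⟩)) with h | h
    · exact hn h
    · exact hNN h

/-- In a compact Hausdorff space, every point of an open set without nontrivial connected subsets
has a neighborhood basis of clopen sets. -/
theorem exists_isClopen_of_isOpen_of_preconnected_subsingleton [CompactSpace X] [T2Space X]
    {U : Set X} (hU : IsOpen U) (hsub : ∀ K ⊆ U, IsPreconnected K → K.Subsingleton) {d : X}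
    (hd : d ∈ U) {N : Set X} (hN : N ∈ 𝓝 d) : ∃ V : Set X, IsClopen V ∧ d ∈ V ∧ V ⊆ N ∩ U := by
  obtain ⟨F, hF, hFc, hFN⟩ := exists_mem_nhds_isClosed_subset (inter_mem hN (hU.mem_nhds hd))
  have : CompactSpace F := isCompact_iff_compactSpace.mp hFc.isCompact
  have : TotallyDisconnectedSpace F := by
    refine ⟨fun K _ hK => ?_⟩
    have h := hsub (Subtype.val '' K) ?_ (hK.image _ continuous_subtype_val.continuousOn)
    · intro x hx y hy
      exact Subtype.ext (h ⟨x, hx, rfl⟩ ⟨y, hy, rfl⟩)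
    · rintro _ ⟨x, -, rfl⟩
      exact (hFN x.2).2
  have hdF : d ∈ F := mem_of_mem_nhds hF
  -- A clopen subset of F that lies in the interior of F is also open in X.
  obtain ⟨V, hV, hdV, hVF⟩ := (loc_compact_Haus_tot_disc_of_zero_dim (H := F)).exists_subset_of_mem_open
    (a := ⟨d, hdF⟩) (u := Subtype.val ⁻¹' interior F) (mem_interior_iff_mem_nhds.mpr hF)
    (isOpen_interior.preimage continuous_subtype_val)
  refine ⟨Subtype.val '' V, ⟨hFc.isClosedEmbedding_subtypeVal.isClosedMap _ hV.1, ?_⟩,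
    ⟨_, hdV, rfl⟩, ?_⟩
  · obtain ⟨O, hO, rfl⟩ := isOpen_induced_iff.mp hV.2
    have : Subtype.val '' ((Subtype.val : F → X) ⁻¹' O) = O ∩ interior F := by
      ext z
      constructor
      · rintro ⟨z, hz, rfl⟩
        exact ⟨hz, hVF hz⟩
      · rintro ⟨hz, hz'⟩
        exact ⟨⟨z, interior_subset hz'⟩, hz, rfl⟩
    rw [this]
    exact hO.inter isOpen_interior
  · rintro _ ⟨z, -, rfl⟩
    exact hFN z.2

theorem totallyDisconnectedSpace_of_isOpen_cover [CompactSpace X] [T2Space X]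
    (h : ∀ d : X, ∃ U : Set X, IsOpen U ∧ d ∈ U ∧ ∀ K ⊆ U, IsPreconnected K → K.Subsingleton) :
    TotallyDisconnectedSpace X := by
  refine ⟨fun K _ hK x hx y hy => ?_⟩
  by_contra hxy
  obtain ⟨U, hU, hxU, hsub⟩ := h x
  obtain ⟨V, hV, hxV, hVs⟩ := exists_isClopen_of_isOpen_of_preconnected_subsingleton hU hsub hxU
    (isOpen_ne.mem_nhds hxy)
  have := hK.subset_isClopen hV ⟨x, hx, hxV⟩ hy
  exact (hVs this).1 rfl

/-- In a connected compact Hausdorff space with more than one point, the complement of a point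
contains a nontrivial connected subset. -/
theorem exists_isPreconnected_nontrivial_notMem [CompactSpace X] [T2Space X] [PreconnectedSpace X]
    [Nontrivial X] (c : X) : ∃ K : Set X, IsPreconnected K ∧ K.Nontrivial ∧ c ∉ K := by
  by_contra! hcon
  obtain ⟨d, hd⟩ := exists_ne c
  obtain ⟨V, hV, hdV, hVs⟩ := exists_isClopen_of_isOpen_of_preconnected_subsingleton
    (U := {c}ᶜ) isOpen_compl_singleton (fun K hK hp => by
      by_contra hn
      exact hK (hcon K hp (not_subsingleton_iff.mp hn)) rfl) hd Filter.univ_mem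
  have := isClopen_iff.mp hV
  rcases this with rfl | rfl
  · exact hdV
  · exact (hVs (mem_univ c)).2 rfl

end ClosedRelations

/-! ### Brouwer's characterization of the Cantor set. -/

section Brouwer

open Topology Filter Set TopologicalSpace

variable {X : Type*} [TopologicalSpace X]

theorem clopens_ne_bot_of_mem {D : Clopens X} {x : X} (h : x ∈ D) : D ≠ ⊥ := by
  rintro rfl
  exact h

theorem exists_mem_of_clopens_ne_bot {D : Clopens X} (h : D ≠ ⊥) : ∃ x, x ∈ D := by
  have : (D : Set X).Nonempty := by
    rw [nonempty_iff_ne_empty]; exact fun h' => h (SetLike.coe_injective h')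
  exact this

/-- If U cuts D properly, cut along U; otherwise both pieces of any splitting are already decided by
U, and a splitting exists because no point is isolated. -/
theorem exists_clopens_split [CompactSpace X] [T2Space X] [TotallyDisconnectedSpace X]
    (hperf : ∀ x : X, ¬ IsOpen {x}) (U : Clopens X) {D : Clopens X} (hD : D ≠ ⊥) :
    ∃ D' : Clopens X, D' ≤ D ∧ D' ≠ ⊥ ∧ D \ D' ≠ ⊥ ∧ (D' ≤ U ∨ Disjoint D' U) ∧
      (D \ D' ≤ U ∨ Disjoint (D \ D') U) := by
  have hpart : ∃ D' : Clopens X, D' ≤ D ∧ D' ≠ ⊥ ∧ D \ D' ≠ ⊥ := by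
    obtain ⟨x, hx⟩ := exists_mem_of_clopens_ne_bot hD
    obtain ⟨y, hy, hyx⟩ : ∃ y ∈ D, y ≠ x := by
      by_contra! h
      have : (D : Set X) = {x} := Subset.antisymm h (by simpa using hx)
      exact hperf x (this ▸ D.2.2)
    obtain ⟨V, hV, hxV, hVs⟩ := compact_exists_isClopen_in_isOpen (isOpen_ne (x := y)) hyx.symm
    refine ⟨D ⊓ ⟨V, hV⟩, inf_le_left, clopens_ne_bot_of_mem (x := x) ⟨hx, hxV⟩,
      clopens_ne_bot_of_mem (x := y) ⟨hy, fun h => hVs h.2 rfl⟩⟩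
  by_cases h1 : D ⊓ U = ⊥
  · obtain ⟨D', h, h', h''⟩ := hpart
    have hdis : Disjoint D U := disjoint_iff.mpr h1
    exact ⟨D', h, h', h'', Or.inr (hdis.mono_left h), Or.inr (hdis.mono_left sdiff_le)⟩
  by_cases h2 : D \ U = ⊥
  · obtain ⟨D', h, h', h''⟩ := hpart
    rw [sdiff_eq_bot_iff] at h2
    exact ⟨D', h, h', h'', Or.inl (h.trans h2), Or.inl (sdiff_le.trans h2)⟩
  · refine ⟨D ⊓ U, inf_le_left, h1, by rwa [sdiff_inf_self_left], Or.inl inf_le_right, Or.inr ?_⟩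
    rw [sdiff_inf_self_left]
    exact disjoint_sdiff_self_left

/-- Brouwer's characterization of the Cantor set. -/
theorem nonempty_homeomorph_nat_bool [CompactSpace X] [T2Space X] [TotallyDisconnectedSpace X]
    [SecondCountableTopology X] [Nonempty X] (hperf : ∀ x : X, ¬ IsOpen {x}) :
    Nonempty (X ≃ₜ (ℕ → Bool)) := by
  classical
  have : Countable (Clopens X) := Clopens.countable_iff_secondCountable.mpr inferInstance
  obtain ⟨U, hU⟩ := exists_surjective_nat (Clopens X)
  have hsplit : ∀ (n : ℕ) (D : {D : Clopens X // D ≠ ⊥}), ∃ D' : Clopens X, D' ≤ D.1 ∧ D' ≠ ⊥ ∧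
      D.1 \ D' ≠ ⊥ ∧ (D' ≤ U n ∨ Disjoint D' (U n)) ∧
      (D.1 \ D' ≤ U n ∨ Disjoint (D.1 \ D') (U n)) :=
    fun n D => exists_clopens_split hperf (U n) D.2
  choose g hgle hg hg' hgU hgU' using hsplit
  -- The n-th splitting decides membership in the n-th clopen set, so the resulting binary tree of
  -- nonempty clopen sets separates points.
  let next : ℕ → Bool → {D : Clopens X // D ≠ ⊥} → {D : Clopens X // D ≠ ⊥} := fun n b D =>
    if b then ⟨g n D, hg n D⟩ else ⟨D.1 \ g n D, hg' n D⟩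
  have hnextU : ∀ n b D, (next n b D).1 ≤ U n ∨ Disjoint (next n b D).1 (U n) := by
    intro n b D
    cases b
    · exact hgU' n D
    · exact hgU n D
  have hnextle : ∀ n b D, (next n b D).1 ≤ D.1 := by
    intro n b D
    cases b
    · exact sdiff_le
    · exact hgle n D
  have htop : (⊤ : Clopens X) ≠ ⊥ := by
    obtain ⟨x⟩ := ‹Nonempty X›
    intro h
    have : x ∈ (⊤ : Clopens X) := trivial
    rw [h] at this
    exact this
  -- E descends the tree along a given branch, S along the branch that contains a given point, and f
  -- records the latter branch.
  let E : (ℕ → Bool) → ℕ → {D : Clopens X // D ≠ ⊥} := fun x n =>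
    Nat.rec ⟨⊤, htop⟩ (fun n D => next n (x n) D) n
  let S : X → ℕ → {D : Clopens X // D ≠ ⊥} := fun a n =>
    Nat.rec ⟨⊤, htop⟩ (fun n D => next n (decide (a ∈ g n D)) D) n
  let f : X → ℕ → Bool := fun a n => decide (a ∈ g n (S a n))
  have hSE : ∀ a n, S a n = E (f a) n := by
    intro a n
    induction n with
    | zero => rfl
    | succ n ih =>
      change next n (f a n) (S a n) = next n (f a n) (E (f a) n)
      rw [ih]
  have hmem_next : ∀ (a : X) n D, a ∈ D.1 → ∀ b, a ∈ (next n b D).1 ↔ b = decide (a ∈ g n D) := by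
    intro a n D ha b
    cases b
    · change a ∈ (D.1 \ g n D : Clopens X) ↔ _
      rw [← SetLike.mem_coe, Clopens.coe_sdiff]
      simp [ha]
    · change a ∈ g n D ↔ _
      simp
  have hmem : ∀ a n, a ∈ (S a n).1 := by
    intro a n
    induction n with
    | zero => trivial
    | succ n ih => exact (hmem_next a n _ ih _).mpr rfl
  have hS : ∀ a b n, b ∈ (S a n).1 → S b n = S a n := by
    intro a b n
    induction n with
    | zero => intro _; rfl
    | succ n ih =>
      intro hb
      have hb' : b ∈ (S a n).1 := hnextle _ _ _ hb
      have h1 := ih hb'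
      have h2 := (hmem_next b n _ hb' _).mp hb
      have h3 : decide (b ∈ g n (S b n)) = decide (a ∈ g n (S a n)) := by rw [h1]; exact h2.symm
      change next n (decide (b ∈ g n (S b n))) (S b n) = next n (decide (a ∈ g n (S a n))) (S a n)
      rw [h3, h1]
  have hcont : Continuous f := by
    refine continuous_pi fun n => IsLocallyConstant.continuous ?_
    rw [IsLocallyConstant.iff_exists_open]
    intro a
    refine ⟨_, (S a (n + 1)).1.2.2, hmem a (n + 1), fun b hb => ?_⟩
    have hb' : b ∈ (S a n).1 := hnextle _ _ _ hb
    change decide (b ∈ g n (S b n)) = _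
    rw [hS a b n hb']
    exact ((hmem_next b n _ hb' _).mp hb).symm
  have hinj : Function.Injective f := by
    intro a b hab
    by_contra hne
    obtain ⟨V, hV, haV, hVs⟩ := compact_exists_isClopen_in_isOpen (isOpen_ne (x := b)) hne
    obtain ⟨n, hn⟩ := hU ⟨V, hV⟩
    have ha := hmem a (n + 1)
    have hSab : S b (n + 1) = S a (n + 1) := by
      have h1 := hSE b (n + 1)
      rw [← hab] at h1
      exact h1.trans (hSE a (n + 1)).symm
    have hb : b ∈ (S a (n + 1)).1 := hSab ▸ hmem b (n + 1)
    rcases hnextU n (f a n) (S a n) with h | h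
    · have := h hb
      rw [hn] at this
      exact hVs this rfl
    · have h3 : a ∈ U n := by rw [hn]; exact haV
      exact (Clopens.ext_iff.mp (disjoint_iff.mp h)).subset ⟨ha, h3⟩
  have hsurj : Function.Surjective f := by
    intro x
    have hne : (⋂ n, ((E x n).1 : Set X)).Nonempty := by
      -- A point in the intersection along the branch x is a preimage of x.
      refine IsCompact.nonempty_iInter_of_sequence_nonempty_isCompact_isClosed _
        (fun n => hnextle n _ _) (fun n => ?_) (E x 0).1.2.1.isCompact (fun n => (E x n).1.2.1)
      rw [nonempty_iff_ne_empty]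
      exact fun h => (E x n).2 (SetLike.coe_injective h)
    obtain ⟨a, ha⟩ := hne
    rw [mem_iInter] at ha
    have hS' : ∀ n, S a n = E x n := by
      intro n
      induction n with
      | zero => rfl
      | succ n ih =>
        have := (hmem_next a n _ (ha n) _).mp (ha (n + 1))
        change next n (decide (a ∈ g n (S a n))) (S a n) = next n (x n) (E x n)
        rw [ih, this]
    refine ⟨a, funext fun n => ?_⟩
    change decide (a ∈ g n (S a n)) = _
    rw [hS' n]
    exact ((hmem_next a n _ (ha n) _).mp (ha (n + 1))).symm
  exact ⟨Continuous.homeoOfEquivCompactToT2 (f := Equiv.ofBijective f ⟨hinj, hsurj⟩) hcont⟩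

end Brouwer

/-! ### Weyl distances and rank two configurations. -/

/-- A thick Weyl distance function on a set of chambers. -/
structure WeylDistance {B W : Type*} [Group W] {M : CoxeterMatrix B} (cs : CoxeterSystem M W)
    (C : Type*) where
  /-- The Weyl distance. -/
  δ : C → C → W
  eq_one_iff : ∀ x y, δ x y = 1 ↔ x = y
  inv : ∀ x y, δ y x = (δ x y)⁻¹
  step : ∀ c x y i, δ x y = cs.simple i → δ c y = δ c x ∨ δ c y = δ c x * cs.simple i
  step_up : ∀ c x y i, δ x y = cs.simple i →
    cs.length (δ c x) < cs.length (δ c x * cs.simple i) → δ c y = δ c x * cs.simple i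
  exists_step : ∀ c x i, ∃ y, δ x y = cs.simple i ∧ δ c y = δ c x * cs.simple i
  thick : ∀ x i, ∃ y z, y ≠ z ∧ δ x y = cs.simple i ∧ δ x z = cs.simple i

namespace CoxeterSystem

variable {B W : Type*} [Group W] {M : CoxeterMatrix B} (cs : CoxeterSystem M W)

/-- The longest element `w` of a rank two parabolic subgroup, the elements of length at most three
below it, and their products with the simple reflections. -/
structure RankTwo (i j i' j' : B) (w u t v r q p : W) (n : ℕ) : Prop where
  ju : cs.simple j * u = w
  it : cs.simple i * t = w
  iv : cs.simple i * v = u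
  jr : cs.simple j * r = t
  jq : cs.simple j * q = v
  ip : cs.simple i * p = r
  uj : u * cs.simple j' = w
  ti : t * cs.simple i' = w
  ri : r * cs.simple i' = u
  vj : v * cs.simple j' = t
  pi : p * cs.simple i' = v
  qj : q * cs.simple j' = r
  hw : cs.length w = n + 3
  hu : cs.length u = n + 2
  ht : cs.length t = n + 2
  hv : cs.length v = n + 1
  hr : cs.length r = n + 1
  hq : cs.length q = n
  hp : cs.length p = n

variable {cs}

theorem RankTwo.symm {i j i' j' : B} {w u t v r q p : W} {n : ℕ}
    (h : cs.RankTwo i j i' j' w u t v r q p n) : cs.RankTwo j i j' i' w t u r v p q n :=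
  ⟨h.it, h.ju, h.jr, h.iv, h.ip, h.jq, h.ti, h.uj, h.vj, h.ri, h.qj, h.pi, h.hw, h.ht, h.hu, h.hr,
    h.hv, h.hp, h.hq⟩

variable (cs)

/-- Since the reflections do not commute, alternating words of length three are reduced, and the
longest element w loses exactly their length when multiplied by them. A primed letter is the
conjugate by w of the unprimed one, so right multiplication by primed letters stays among the words
times w. -/
theorem exists_rankTwo [Finite W] {i j : B} (hij : ¬ Commute (cs.simple i) (cs.simple j)) :
    ∃ i' j' w u t v r q p n, cs.RankTwo i j i' j' w u t v r q p n := by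
  obtain ⟨w, hw⟩ := cs.exists_isLongest {i, j}
  obtain ⟨i', -, hi'⟩ := hw.exists_opposite (j := i) (by simp)
  obtain ⟨j', -, hj'⟩ := hw.exists_opposite (j := j) (by simp)
  have hi : cs.simple i ∈ cs.parabolic {i, j} := cs.simple_mem_parabolic (by simp)
  have hj : cs.simple j ∈ cs.parabolic {i, j} := cs.simple_mem_parabolic (by simp)
  have hne : cs.simple i ≠ cs.simple j := fun h => hij (by rw [h])
  have h1 := hw.left _ hi
  have h2 := hw.left _ hj
  have h3 := hw.left _ (mul_mem hi hj)
  have h4 := hw.left _ (mul_mem hj hi)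
  have h5 := hw.left _ (mul_mem (mul_mem hi hj) hi)
  have h6 := hw.left _ (mul_mem (mul_mem hj hi) hj)
  rw [length_simple] at h1 h2
  rw [cs.length_simple_mul_simple_of_ne hne] at h3
  rw [cs.length_simple_mul_simple_of_ne hne.symm] at h4
  rw [cs.length_simple_mul_simple_mul_simple_of_not_commute hij] at h5
  rw [cs.length_simple_mul_simple_mul_simple_of_not_commute fun h => hij h.symm] at h6
  simp only [mul_assoc] at h1 h2 h3 h4 h5 h6
  have hi'' : w * cs.simple i' = cs.simple i * w := hi'.symm
  have hj'' : w * cs.simple j' = cs.simple j * w := hj'.symm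
  refine ⟨i', j', w, cs.simple j * w, cs.simple i * w, cs.simple i * (cs.simple j * w),
    cs.simple j * (cs.simple i * w), cs.simple j * (cs.simple i * (cs.simple j * w)),
    cs.simple i * (cs.simple j * (cs.simple i * w)),
    cs.length (cs.simple i * (cs.simple j * (cs.simple i * w))), ?_⟩
  constructor <;> first | omega | simp [mul_assoc, hi'', hj'']

variable {cs} in
theorem IsIrreducible.exists_not_commute [Nontrivial B] (h : cs.IsIrreducible) (i : B) :
    ∃ j, ¬ Commute (cs.simple i) (cs.simple j) := by
  obtain ⟨k, hk⟩ := exists_ne i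
  obtain ⟨i', hi', j, -, hij⟩ := h {i} ⟨i, rfl⟩ ⟨k, hk⟩
  rw [Set.mem_singleton_iff.mp hi'] at hij
  exact ⟨j, hij⟩

end CoxeterSystem

/-! ### Combinatorics of panels and homogeneity. -/

namespace WeylDistance

variable {B W C : Type*} [Group W] {M : CoxeterMatrix B} {cs : CoxeterSystem M W}
  (D : WeylDistance cs C)

/-- Two chambers are `i`-adjacent if they are equal or at distance `s_i`. -/
def Adj (i : B) (x y : C) : Prop := x = y ∨ D.δ x y = cs.simple i

variable {D} {i j k : B} {c d x y z : C} {g : W} {n : ℕ}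

theorem δ_self (x : C) : D.δ x x = 1 := (D.eq_one_iff x x).mpr rfl

theorem ne_of_δ_eq_simple (h : D.δ x y = cs.simple i) : x ≠ y := by
  intro he
  rw [← D.eq_one_iff, h, ← cs.length_eq_zero_iff, cs.length_simple] at he
  exact one_ne_zero he

theorem Adj.refl (i : B) (x : C) : D.Adj i x x := Or.inl rfl

theorem Adj.symm (h : D.Adj i x y) : D.Adj i y x := by
  rcases h with rfl | h
  · exact Or.inl rfl
  · right; rw [D.inv, h, cs.inv_simple]

theorem Adj.trans (h : D.Adj i x y) (h' : D.Adj i y z) : D.Adj i x z := by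
  rcases h' with rfl | h'
  · exact h
  rcases h with rfl | h
  · exact Or.inr h'
  · rcases D.step x y z i h' with h1 | h1
    · exact Or.inr (h1.trans h)
    · rw [h, cs.simple_mul_simple_self] at h1
      exact Or.inl ((D.eq_one_iff _ _).mp h1)

theorem exists_adj_ne_ne (i : B) (x z : C) : ∃ y, D.Adj i x y ∧ y ≠ x ∧ y ≠ z := by
  obtain ⟨y, y', hne, hy, hy'⟩ := D.thick x i
  by_cases h : y = z
  · exact ⟨y', Or.inr hy', (ne_of_δ_eq_simple hy').symm, fun h' => hne (h.trans h'.symm)⟩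
  · exact ⟨y, Or.inr hy, (ne_of_δ_eq_simple hy).symm, h⟩

theorem right_up (h0 : D.δ c x = g) (hl : cs.length g < cs.length (g * cs.simple i))
    (h : D.Adj i x y) (hne : y ≠ x) : D.δ c y = g * cs.simple i := by
  rcases h with rfl | h
  · exact absurd rfl hne
  · subst h0
    exact D.step_up c x y i h hl

theorem right_cases (h0 : D.δ c x = g) (h : D.Adj i x y) :
    D.δ c y = g ∨ D.δ c y = g * cs.simple i := by
  rcases h with rfl | h
  · exact Or.inl h0
  · subst h0
    exact D.step c x y i h

theorem exists_right (h0 : D.δ c x = g) (i : B) :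
    ∃ y, D.Adj i x y ∧ y ≠ x ∧ D.δ c y = g * cs.simple i := by
  obtain ⟨y, hy, hy'⟩ := D.exists_step c x i
  exact ⟨y, Or.inr hy, (ne_of_δ_eq_simple hy).symm, h0 ▸ hy'⟩

theorem right_unique (h0 : D.δ c x = g) (hl : cs.length g < cs.length (g * cs.simple i))
    (h : D.Adj i x y) (hy : cs.length (D.δ c y) < cs.length (g * cs.simple i)) : y = x := by
  by_contra hne
  rw [right_up h0 hl h hne] at hy
  exact lt_irrefl _ hy

theorem left_up (h0 : D.δ x c = g) (hl : cs.length g < cs.length (cs.simple i * g))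
    (h : D.Adj i x y) (hne : y ≠ x) : D.δ y c = cs.simple i * g := by
  have h1 : D.δ c x = g⁻¹ := by rw [D.inv, h0]
  have h2 : cs.length g⁻¹ < cs.length (g⁻¹ * cs.simple i) := by
    rw [cs.length_inv, ← cs.length_inv (g⁻¹ * _)]
    simpa using hl
  rw [D.inv, right_up h1 h2 h hne]
  simp

theorem left_cases (h0 : D.δ x c = g) (h : D.Adj i x y) :
    D.δ y c = g ∨ D.δ y c = cs.simple i * g := by
  have h1 : D.δ c x = g⁻¹ := by rw [D.inv, h0]
  rcases right_cases h1 h with h2 | h2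
  · left; rw [D.inv, h2, inv_inv]
  · right; rw [D.inv, h2]; simp

theorem exists_left (h0 : D.δ x c = g) (i : B) :
    ∃ y, D.Adj i x y ∧ y ≠ x ∧ D.δ y c = cs.simple i * g := by
  have h1 : D.δ c x = g⁻¹ := by rw [D.inv, h0]
  obtain ⟨y, hy, hne, h2⟩ := exists_right h1 i
  refine ⟨y, hy, hne, ?_⟩
  rw [D.inv, h2]; simp

theorem left_unique (h0 : D.δ x c = g) (hl : cs.length g < cs.length (cs.simple i * g))
    (h : D.Adj i x y) (hy : cs.length (D.δ y c) < cs.length (cs.simple i * g)) : y = x := by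
  by_contra hne
  rw [left_up h0 hl h hne] at hy
  exact lt_irrefl _ hy

theorem exists_δ_eq (c : C) (g : W) : ∃ d, D.δ c d = g := by
  induction g using cs.simple_induction_right with
  | one => exact ⟨c, δ_self c⟩
  | mul_simple_right w i ih =>
    obtain ⟨d, hd⟩ := ih
    obtain ⟨y, -, -, hy⟩ := exists_right hd i
    exact ⟨y, hy⟩

theorem exists_δ_eq' (c : C) (g : W) : ∃ d, D.δ d c = g := by
  obtain ⟨d, hd⟩ := exists_δ_eq (D := D) c g⁻¹
  exact ⟨d, by rw [D.inv, hd, inv_inv]⟩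

/-- A relation between chambers that is implied by adjacency holds everywhere, if it is reflexive
and transitive. -/
theorem induction_adj {R : C → C → Prop} (hrefl : ∀ x, R x x)
    (htrans : ∀ x y z, R x y → R y z → R x z) (hadj : ∀ i x y, D.Adj i x y → R x y) (x y : C) :
    R x y := by
  suffices h : ∀ g : W, ∀ y, D.δ x y = g → R x y from h _ y rfl
  intro g
  induction g using cs.simple_induction_right with
  | one =>
    intro y hy
    rw [(D.eq_one_iff _ _).mp hy]
    exact hrefl y
  | mul_simple_right w i ih =>
    intro y hy
    obtain ⟨z, hz, -, hxz⟩ := exists_right hy i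
    rw [cs.simple_mul_simple_cancel_right] at hxz
    exact htrans _ _ _ (ih z hxz) (hadj i _ _ hz.symm)

/-- A predicate on panels that is invariant under perspectivities is constant on the panels of a
given type. -/
theorem homogeneous [Finite W] (hirr : ∀ i : B, ∃ j, ¬ Commute (cs.simple i) (cs.simple j))
    {S : B → C → Prop}
    (hS : ∀ i k t c d, cs.simple i * t = t * cs.simple k →
      cs.length t < cs.length (cs.simple i * t) → D.δ c d = t → (S i c ↔ S k d))
    (i : B) (c d : C) : S i c ↔ S i d := by
  have hlink : ∀ {i j i' j' : B} {w u t v r q p : W} {n : ℕ},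
      cs.RankTwo i j i' j' w u t v r q p n → ∀ c d, D.δ c d = t → (S i c ↔ S i' d) := by
    intro i j i' j' w u t v r q p n h c d hcd
    exact hS i i' t c d (by rw [h.it, h.ti]) (by rw [h.it, h.hw, h.ht]; omega) hcd
  -- A third chamber `c1` of the panel is placed closer to d than both c and c'; then both are at
  -- distance t from d and their i-panels are perspective to the same pointed panel at d.
  have hnc : ∀ j c c', ¬ Commute (cs.simple i) (cs.simple j) → D.Adj j c c' → (S i c ↔ S i c') := by
    intro j c c' hij hcc
    obtain ⟨i', j', w, u, t, v, r, q, p, n, h⟩ := cs.exists_rankTwo hij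
    obtain ⟨c1, hc1, h1, h2⟩ := exists_adj_ne_ne (D := D) j c c'
    obtain ⟨d, hd⟩ := exists_δ_eq (D := D) c1 r
    have hl : cs.length r < cs.length (cs.simple j * r) := by rw [h.jr, h.hr, h.ht]; omega
    have e1 := left_up hd hl hc1.symm h1.symm
    have e2 := left_up hd hl (hc1.symm.trans hcc) h2.symm
    rw [h.jr] at e1 e2
    rw [hlink h c d e1, hlink h c' d e2]
  refine induction_adj (D := D) (R := fun c d => S i c ↔ S i d) (fun _ => Iff.rfl)
    (fun _ _ _ h h' => h.trans h') (fun k c c' hcc => ?_) c d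
  -- For commuting distinct reflections the panels of c and c' are perspective to each other, with t
  -- the reflection of type k. If the reflections coincide, c and c' lie in one i-panel; a step of a
  -- non-commuting type j from each reaches distance t from a common d.
  by_cases hk : Commute (cs.simple i) (cs.simple k)
  · by_cases hki : cs.simple k = cs.simple i
    · have hcc' : D.Adj i c c' := by rwa [Adj, ← hki]
      obtain ⟨j, hij⟩ := hirr i
      obtain ⟨i', j', w, u, t, v, r, q, p, n, h⟩ := cs.exists_rankTwo hij
      obtain ⟨c1, hc1, h1, h2⟩ := exists_adj_ne_ne (D := D) i c c'
      obtain ⟨d, hd⟩ := exists_δ_eq (D := D) c1 p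
      have hl : cs.length p < cs.length (cs.simple i * p) := by rw [h.ip, h.hr, h.hp]; omega
      have hl' : cs.length r < cs.length (cs.simple j * r) := by rw [h.jr, h.hr, h.ht]; omega
      have key : ∀ x, D.Adj i c1 x → x ≠ c1 → (S i x ↔ S i' d) := by
        intro x hx hne
        have e1 := left_up hd hl hx hne
        rw [h.ip] at e1
        obtain ⟨x', hx', hne', -⟩ := exists_adj_ne_ne (D := D) j x x
        have e2 := left_up e1 hl' hx' hne'
        rw [h.jr] at e2
        rw [hnc j x x' hij hx', hlink h x' d e2]
      rw [key c hc1.symm h1.symm, key c' (hc1.symm.trans hcc') h2.symm]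
    · rcases hcc with rfl | hcc
      · rfl
      · refine hS i i _ c c' hk.eq ?_ hcc
        rw [cs.length_simple_mul_simple_of_ne (Ne.symm hki), cs.length_simple]
        omega
  · exact hnc k c c' hk hcc

end WeylDistance

/-! ### Closed adjacency, continuous projections and total disconnectedness. -/

namespace WeylDistance

open Set Topology TopologicalSpace

variable {B W C : Type*} [Group W] {M : CoxeterMatrix B} {cs : CoxeterSystem M W}
  {D : WeylDistance cs C} {i j k : B} {c d x y z : C} {g : W} {n : ℕ}

/-- This y is the projection of c to the panel. Uniqueness is stated through a length bound because
such bounds turn out to be closed conditions. -/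
theorem existsUnique_right (hl : cs.length g < cs.length (g * cs.simple i))
    (h : D.δ c x = g ∨ D.δ c x = g * cs.simple i) :
    ∃ y, D.Adj i x y ∧ D.δ c y = g ∧ ∀ z, D.Adj i x z → cs.length (D.δ c z) ≤ cs.length g →
      z = y := by
  rcases h with h | h
  · exact ⟨x, Adj.refl i x, h, fun z hz hz' => right_unique h hl hz (by omega)⟩
  · obtain ⟨y, hy, -, hcy⟩ := exists_right h i
    rw [cs.simple_mul_simple_cancel_right] at hcy
    exact ⟨y, hy, hcy, fun z hz hz' => right_unique hcy hl (hy.symm.trans hz) (by omega)⟩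

theorem existsUnique_left (hl : cs.length g < cs.length (cs.simple i * g))
    (h : D.δ x c = g ∨ D.δ x c = cs.simple i * g) :
    ∃ y, D.Adj i x y ∧ D.δ y c = g ∧ ∀ z, D.Adj i x z → cs.length (D.δ z c) ≤ cs.length g →
      z = y := by
  rcases h with h | h
  · exact ⟨x, Adj.refl i x, h, fun z hz hz' => left_unique h hl hz (by omega)⟩
  · obtain ⟨y, hy, -, hcy⟩ := exists_left h i
    rw [cs.simple_mul_simple_cancel_left] at hcy
    exact ⟨y, hy, hcy, fun z hz hz' => left_unique hcy hl (hy.symm.trans hz) (by omega)⟩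

theorem length_δ_le_succ (h : D.Adj i x y) : cs.length (D.δ c y) ≤ cs.length (D.δ c x) + 1 := by
  rcases right_cases (c := c) rfl h with h1 | h1
  · rw [h1]; omega
  · rw [h1]
    have := cs.length_mul_simple (D.δ c x) i
    omega

theorem length_δ_le_succ_iff :
    cs.length (D.δ c d) ≤ n + 1 ↔
      cs.length (D.δ c d) ≤ n ∨ ∃ i z, cs.length (D.δ c z) ≤ n ∧ D.Adj i z d := by
  constructor
  · intro h
    by_cases hn : cs.length (D.δ c d) ≤ n
    · exact Or.inl hn
    right
    have hne : D.δ c d ≠ 1 := by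
      intro h1
      rw [h1, cs.length_one] at hn
      omega
    obtain ⟨i, hi⟩ := cs.exists_rightDescent_of_ne_one hne
    obtain ⟨z, hz, -, hcz⟩ := exists_right (D := D) rfl i
    refine ⟨i, z, ?_, hz.symm⟩
    rw [hcz]
    have := cs.isRightDescent_iff.mp hi
    omega
  · rintro (h | ⟨i, z, hz, hzd⟩)
    · omega
    · have := length_δ_le_succ (c := c) hzd
      omega

variable (D) in
/-- The `i`-panel of a chamber. -/
def panel (i : B) (c : C) : Set C := {d | D.Adj i c d}

theorem mem_panel_self (i : B) (c : C) : c ∈ D.panel i c := Adj.refl i c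

theorem panel_eq (h : d ∈ D.panel i c) : D.panel i d = D.panel i c :=
  Set.ext fun _ => ⟨fun hx => Adj.trans h hx, fun hx => Adj.trans (Adj.symm h) hx⟩

variable [TopologicalSpace C]

variable (D) in
/-- Adjacency is closed in every type. -/
def ClosedAdj : Prop := ∀ i, IsClosed {p : C × C | D.Adj i p.1 p.2}

theorem ClosedAdj.isClosed (hD : D.ClosedAdj) {X : Type*} [TopologicalSpace X] (i : B) {f g : X → C}
    (hf : Continuous f) (hg : Continuous g) : IsClosed {x | D.Adj i (f x) (g x)} :=
  (hD i).preimage (hf.prodMk hg)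

theorem ClosedAdj.isClosed_panel (hD : D.ClosedAdj) (i : B) (c : C) : IsClosed (D.panel i c) :=
  hD.isClosed i continuous_const continuous_id

/-- A ball of radius n + 1 consists of the ball of radius n and the chambers adjacent to it in one
of finitely many types; the intermediate chamber ranges over a compact space. -/
theorem ClosedAdj.isClosed_length_le (hD : D.ClosedAdj) [Finite B] [CompactSpace C] [T2Space C]
    {X : Type*} [TopologicalSpace X] (n : ℕ) {f g : X → C} (hf : Continuous f) (hg : Continuous g) :
    IsClosed {x | cs.length (D.δ (f x) (g x)) ≤ n} := by
  suffices h : IsClosed {p : C × C | cs.length (D.δ p.1 p.2) ≤ n} from h.preimage (hf.prodMk hg)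
  clear hf hg f g
  induction n with
  | zero =>
    have : {p : C × C | cs.length (D.δ p.1 p.2) ≤ 0} = {p | p.1 = p.2} := by
      ext p
      simp only [mem_ofPred_eq, nonpos_iff_eq_zero, cs.length_eq_zero_iff, D.eq_one_iff]
    rw [this]
    exact isClosed_eq continuous_fst continuous_snd
  | succ n ih =>
    have : {p : C × C | cs.length (D.δ p.1 p.2) ≤ n + 1} =
        {p | cs.length (D.δ p.1 p.2) ≤ n} ∪
          ⋃ i, {p | ∃ z, cs.length (D.δ p.1 z) ≤ n ∧ D.Adj i z p.2} := by
      ext p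
      simp only [mem_ofPred_eq, length_δ_le_succ_iff, mem_union, mem_iUnion]
    rw [this]
    refine ih.union (isClosed_iUnion_of_finite fun i => isClosed_setOf_exists ?_)
    exact (ih.preimage (f := fun q : (C × C) × C => (q.1.1, q.2)) (by fun_prop)).and
      (hD.isClosed i (by fun_prop) (by fun_prop))

theorem ClosedAdj.isOpen_δ_eq (hD : D.ClosedAdj) [Finite B] [CompactSpace C] [T2Space C]
    {X : Type*} [TopologicalSpace X] {w : W} (hw : cs.IsLongest univ w) {f g : X → C} (hf : Continuous f)
    (hg : Continuous g) : IsOpen {x | D.δ (f x) (g x) = w} := by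
  have : {x | D.δ (f x) (g x) = w} = {x | cs.length (D.δ (f x) (g x)) + 1 ≤ cs.length w}ᶜ := by
    ext x
    simp only [mem_ofPred_eq, mem_compl_iff]
    constructor
    · intro h; rw [h]; omega
    · intro h; exact hw.eq_of_length_le (by omega)
  rw [this, isOpen_compl_iff]
  -- Being non-opposite is the bound by `cs.length w - 1`, which is an empty condition when w has
  -- length zero.
  cases h : cs.length w with
  | zero => simp
  | succ m => simpa using hD.isClosed_length_le m hf hg

/-- Perspectivities between opposite panels are homeomorphisms. -/
theorem ClosedAdj.exists_homeomorph (hD : D.ClosedAdj) [Finite B] [CompactSpace C] [T2Space C]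
    {t : W} (ht : cs.simple i * t = t * cs.simple k) (hl : cs.length t < cs.length (cs.simple i * t))
    (hcd : D.δ c d = t) :
    ∃ e : D.panel i c ≃ₜ D.panel k d, e ⟨c, mem_panel_self i c⟩ = ⟨d, mem_panel_self k d⟩ := by
  have : CompactSpace (D.panel i c) :=
    isCompact_iff_compactSpace.mp (hD.isClosed_panel i c).isCompact
  have : CompactSpace (D.panel k d) :=
    isCompact_iff_compactSpace.mp (hD.isClosed_panel k d).isCompact
  obtain ⟨e, he⟩ := exists_homeomorph_of_isClosed_rel
    (R := fun (x : D.panel i c) (y : D.panel k d) => cs.length (D.δ x.1 y.1) ≤ cs.length t)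
    (hD.isClosed_length_le _ (by fun_prop) (by fun_prop))
    (by
      rintro ⟨x, hx⟩
      have h1 := left_cases hcd hx
      rw [ht] at h1 hl
      obtain ⟨y, hy, hy', hu⟩ := existsUnique_right hl h1
      exact ⟨⟨y, hy⟩, by simp [hy'], fun z hz => Subtype.ext (hu z z.2 hz)⟩)
    (by
      rintro ⟨y, hy⟩
      have h1 := right_cases hcd hy
      rw [← ht] at h1
      obtain ⟨x, hx, hx', hu⟩ := existsUnique_left hl h1
      exact ⟨⟨x, hx⟩, by simp [hx'], fun z hz => Subtype.ext (hu z z.2 hz)⟩)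
  refine ⟨e, Subtype.ext ?_⟩
  rw [ht] at hl
  exact right_unique hcd hl (e _).2 ((he ⟨c, mem_panel_self i c⟩).trans_lt hl)

theorem preconnectedSpace_of_panels (hp : ∀ i c, IsPreconnected (D.panel i c)) :
    PreconnectedSpace C := by
  rw [preconnectedSpace_iff_connectedComponent]
  intro x
  ext y
  simp only [mem_univ, iff_true]
  have h : connectedComponent x = connectedComponent y :=
    induction_adj (D := D) (R := fun x y => connectedComponent x = connectedComponent y)
      (fun _ => rfl) (fun _ _ _ h h' => h.trans h') (fun i x y hxy =>
        connectedComponent_eq ((hp i x).subset_connectedComponent (mem_panel_self i x) hxy)) x y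
  rw [h]
  exact mem_connectedComponent

section Connectedness

variable [Finite B] [CompactSpace C] [T2Space C]

/-- If panels have no nontrivial connected subsets, then neither do the cells. -/
theorem ClosedAdj.subsingleton_of_cell (hD : D.ClosedAdj)
    (hp : ∀ i c, ∀ K ⊆ D.panel i c, IsPreconnected K → K.Subsingleton) (g : W) (c : C) :
    ∀ K ⊆ {d | D.δ c d = g}, IsPreconnected K → K.Subsingleton := by
  induction hn : cs.length g generalizing g c with
  | zero =>
    intro K hK _ x hx y hy
    rw [cs.length_eq_zero_iff] at hn
    have h1 := hK hx
    have h2 := hK hy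
    rw [mem_ofPred_eq, hn, D.eq_one_iff] at h1 h2
    rw [← h1, ← h2]
  | succ n ih =>
    intro K hK hKp x hx y hy
    have hne : g ≠ 1 := by
      rintro rfl
      rw [cs.length_one] at hn
      omega
    obtain ⟨i, hi⟩ := cs.exists_leftDescent_of_ne_one hne
    obtain ⟨g', rfl⟩ : ∃ g', g = cs.simple i * g' := ⟨cs.simple i * g, by simp⟩
    have hl : cs.length g' < cs.length (cs.simple i * g') := by
      have h1 := cs.isLeftDescent_iff.mp hi
      rw [cs.simple_mul_simple_cancel_left] at h1
      omega
    have hn' : cs.length g' = n := by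
      have := cs.length_simple_mul g' i
      omega
    have huniq : ∀ d ∈ K, ∃ c1, D.Adj i c c1 ∧ D.δ c1 d = g' ∧
        ∀ z, D.Adj i c z → cs.length (D.δ z d) ≤ cs.length g' → z = c1 :=
      fun d hd => existsUnique_left hl (Or.inr (hK hd))
    -- The projection of the cell to the i-panel of c sends K to a connected set, hence to one point
    -- `c1`. So K lies in the shorter cell around `c1`.
    have himg := hKp.image_of_isClosed_rel
      (R := fun d c1 => D.Adj i c c1 ∧ cs.length (D.δ c1 d) ≤ cs.length g')
      ((hD.isClosed i (by fun_prop) (by fun_prop)).and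
        (hD.isClosed_length_le _ (by fun_prop) (by fun_prop))) (fun d hd => by
          obtain ⟨c1, h1, h2, h3⟩ := huniq d hd
          exact ⟨c1, ⟨h1, by rw [h2]⟩, fun z hz => h3 z hz.1 hz.2⟩)
    have hsub := hp i c _ (by rintro c1 ⟨d, -, h, -⟩; exact h) himg
    obtain ⟨c1, h1, h2, h3⟩ := huniq x hx
    refine ih g' c1 hn' K (fun d hd => ?_) hKp hx hy
    obtain ⟨c2, h1', h2', -⟩ := huniq d hd
    have : c2 = c1 := hsub ⟨d, hd, h1', by rw [h2']⟩ ⟨x, hx, h1, by rw [h2]⟩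
    rw [← this]
    exact h2'

theorem ClosedAdj.totallyDisconnectedSpace (hD : D.ClosedAdj) [Finite W]
    (hp : ∀ i c, ∀ K ⊆ D.panel i c, IsPreconnected K → K.Subsingleton) :
    TotallyDisconnectedSpace C := by
  refine totallyDisconnectedSpace_of_isOpen_cover fun d => ?_
  obtain ⟨w, hw⟩ := cs.exists_isLongest univ
  obtain ⟨c, hc⟩ := exists_δ_eq' (D := D) d w
  exact ⟨{d | D.δ c d = w}, hD.isOpen_δ_eq hw continuous_const continuous_id, hc,
    hD.subsingleton_of_cell hp w c⟩

end Connectedness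

end WeylDistance

/-! ### Connected panels and the dichotomy. -/

namespace CoxeterSystem.RankTwo

variable {B W : Type*} [Group W] {M : CoxeterMatrix B} {cs : CoxeterSystem M W}
  {i j i' j' : B} {w u t v r q p : W} {n : ℕ}

theorem jw (h : cs.RankTwo i j i' j' w u t v r q p n) : cs.simple j * w = u := by
  rw [← h.ju, cs.simple_mul_simple_cancel_left]

theorem iw (h : cs.RankTwo i j i' j' w u t v r q p n) : cs.simple i * w = t := by
  rw [← h.it, cs.simple_mul_simple_cancel_left]

theorem jv (h : cs.RankTwo i j i' j' w u t v r q p n) : cs.simple j * v = q := by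
  rw [← h.jq, cs.simple_mul_simple_cancel_left]

theorem wj (h : cs.RankTwo i j i' j' w u t v r q p n) : w * cs.simple j' = u := by
  rw [← h.uj, cs.simple_mul_simple_cancel_right]

theorem tj (h : cs.RankTwo i j i' j' w u t v r q p n) : t * cs.simple j' = v := by
  rw [← h.vj, cs.simple_mul_simple_cancel_right]

theorem ui (h : cs.RankTwo i j i' j' w u t v r q p n) : u * cs.simple i' = r := by
  rw [← h.ri, cs.simple_mul_simple_cancel_right]

theorem rj (h : cs.RankTwo i j i' j' w u t v r q p n) : r * cs.simple j' = q := by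
  rw [← h.qj, cs.simple_mul_simple_cancel_right]

end CoxeterSystem.RankTwo

namespace WeylDistance

open Set Topology TopologicalSpace

variable {B W C : Type*} [Group W] {M : CoxeterMatrix B} {cs : CoxeterSystem M W}
  {D : WeylDistance cs C} {i j k i' j' : B} {c d x y z : C} {g w u t v r q p : W} {n : ℕ}

theorem δ_iu (h : cs.RankTwo i j i' j' w u t v r q p n) (h0 : D.δ x c = v) (hy : D.Adj i x y)
    (hne : y ≠ x) : D.δ y c = u :=
  (left_up h0 (by rw [h.iv, h.hv, h.hu]; omega) hy hne).trans h.iv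

theorem δ_jw (h : cs.RankTwo i j i' j' w u t v r q p n) (h0 : D.δ x c = u) (hy : D.Adj j x y)
    (hne : y ≠ x) : D.δ y c = w :=
  (left_up h0 (by rw [h.ju, h.hu, h.hw]; omega) hy hne).trans h.ju

theorem δ_jv (h : cs.RankTwo i j i' j' w u t v r q p n) (h0 : D.δ x c = q) (hy : D.Adj j x y)
    (hne : y ≠ x) : D.δ y c = v :=
  (left_up h0 (by rw [h.jq, h.hq, h.hv]; omega) hy hne).trans h.jq

theorem δ_wj' (h : cs.RankTwo i j i' j' w u t v r q p n) (h0 : D.δ c x = u) (hy : D.Adj j' x y)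
    (hne : y ≠ x) : D.δ c y = w :=
  (right_up h0 (by rw [h.uj, h.hu, h.hw]; omega) hy hne).trans h.uj

theorem δ_ui' (h : cs.RankTwo i j i' j' w u t v r q p n) (h0 : D.δ c x = r) (hy : D.Adj i' x y)
    (hne : y ≠ x) : D.δ c y = u :=
  (right_up h0 (by rw [h.ri, h.hr, h.hu]; omega) hy hne).trans h.ri

theorem δ_rj' (h : cs.RankTwo i j i' j' w u t v r q p n) (h0 : D.δ c x = q) (hy : D.Adj j' x y)
    (hne : y ≠ x) : D.δ c y = r :=
  (right_up h0 (by rw [h.qj, h.hq, h.hr]; omega) hy hne).trans h.qj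

theorem eq_of_δ_u (h : cs.RankTwo i j i' j' w u t v r q p n) (h0 : D.δ x c = u)
    (hy : D.Adj j x y) (hl : cs.length (D.δ y c) ≤ n + 2) : y = x :=
  left_unique h0 (by rw [h.ju, h.hu, h.hw]; omega) hy (by rw [h.ju, h.hw]; omega)

theorem eq_of_δ_u' (h : cs.RankTwo i j i' j' w u t v r q p n) (h0 : D.δ c x = u)
    (hy : D.Adj j' x y) (hl : cs.length (D.δ c y) ≤ n + 2) : y = x :=
  right_unique h0 (by rw [h.uj, h.hu, h.hw]; omega) hy (by rw [h.uj, h.hw]; omega)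

theorem exists_δ_u (h : cs.RankTwo i j i' j' w u t v r q p n) (h0 : D.δ x c = w) :
    ∃ y, D.Adj j x y ∧ y ≠ x ∧ D.δ y c = u := by
  rw [← h.jw]
  exact exists_left h0 j

theorem exists_δ_u' (h : cs.RankTwo i j i' j' w u t v r q p n) (h0 : D.δ c x = w) :
    ∃ y, D.Adj j' x y ∧ y ≠ x ∧ D.δ c y = u := by
  rw [← h.wj]
  exact exists_right h0 j'

/-- A set contains a nontrivial connected subset avoiding a given point. -/
def HasPuncturedContinuum [TopologicalSpace C] (P : Set C) (c : C) : Prop :=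
  ∃ K : Set P, IsPreconnected K ∧ K.Nontrivial ∧ ∀ x ∈ K, x.1 ≠ c

variable [TopologicalSpace C] [CompactSpace C] [T2Space C]

theorem ClosedAdj.hasPuncturedContinuum_of_isPreconnected (hD : D.ClosedAdj)
    (h : IsPreconnected (D.panel i c)) : HasPuncturedContinuum (D.panel i c) c := by
  have := isPreconnected_iff_preconnectedSpace.mp h
  have : CompactSpace (D.panel i c) :=
    isCompact_iff_compactSpace.mp (hD.isClosed_panel i c).isCompact
  obtain ⟨y, hy, hne, -⟩ := exists_adj_ne_ne (D := D) i c c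
  have : Nontrivial (D.panel i c) :=
    ⟨⟨c, mem_panel_self i c⟩, ⟨y, hy⟩, fun h => hne (congrArg Subtype.val h).symm⟩
  obtain ⟨K, hK, hn, hc⟩ := exists_isPreconnected_nontrivial_notMem
    (⟨c, mem_panel_self i c⟩ : D.panel i c)
  exact ⟨K, hK, hn, fun x hx hxc => hc (by convert hx; exact hxc.symm)⟩

variable [Finite B]

theorem ClosedAdj.hasPuncturedContinuum_iff (hD : D.ClosedAdj) [Finite W]
    (hirr : ∀ i : B, ∃ j, ¬ Commute (cs.simple i) (cs.simple j)) (i : B) (c d : C) :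
    HasPuncturedContinuum (D.panel i c) c ↔ HasPuncturedContinuum (D.panel i d) d := by
  refine homogeneous (D := D) (S := fun i c => HasPuncturedContinuum (D.panel i c) c) hirr ?_ i c d
  have key : ∀ (P Q : Set C) (c d : C) (hc : c ∈ P) (hd : d ∈ Q) (e : P ≃ₜ Q),
      e ⟨c, hc⟩ = ⟨d, hd⟩ → HasPuncturedContinuum P c → HasPuncturedContinuum Q d := by
    rintro P Q c d hc hd e he ⟨K, hK, hn, hKc⟩
    refine ⟨e '' K, hK.image _ e.continuous.continuousOn, hn.image e.injective, ?_⟩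
    rintro _ ⟨x, hx, rfl⟩ hxd
    have h1 : e x = e ⟨c, hc⟩ := by rw [he]; exact Subtype.ext hxd
    exact hKc x hx (congrArg Subtype.val (e.injective h1))
  intro i k t c d ht hl hcd
  obtain ⟨e, he⟩ := hD.exists_homeomorph ht hl hcd
  exact ⟨key _ _ _ _ _ _ e he, key _ _ _ _ _ _ e.symm (by rw [← he, e.symm_apply_apply])⟩

/-- Any two points of a panel different from the projection of `c₀` lie in a connected subset. -/
theorem ClosedAdj.exists_isPreconnected_of_ne (hD : D.ClosedAdj)
    (h : cs.RankTwo i j i' j' w u t v r q p n)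
    (hS : ∀ c, HasPuncturedContinuum (D.panel i c) c) {c₀ a b : C} (ha : D.Adj j' c₀ a)
    (hb : D.Adj j' c₀ b) (hac : a ≠ c₀) (hbc : b ≠ c₀) :
    ∃ K ⊆ D.panel j' c₀, a ∈ K ∧ b ∈ K ∧ IsPreconnected K := by
  obtain ⟨c₂, hc⟩ := exists_δ_eq' (D := D) c₀ v
  obtain ⟨K, hK, ⟨⟨x, hx⟩, hxK, ⟨x', hx'⟩, hxK', hne⟩, hKc⟩ := hS c₂
  have hne : x ≠ x' := fun h => hne (Subtype.ext h)
  have hxc := hKc _ hxK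
  have hxc' := hKc _ hxK'
  have hxx' : D.Adj i x x' := (Adj.symm hx).trans hx'
  -- The aim is a chamber e whose projections to the j-panels of x and x' are y and y', while the
  -- projections of y and y' to the j'-panel of `c₀` are a and b.
  obtain ⟨y, hxy, hyx, hya⟩ := exists_δ_u h (δ_wj' h (δ_iu h hc hx hxc) ha hac)
  obtain ⟨y', hxy', hyx', hyb⟩ := exists_δ_u h (δ_wj' h (δ_iu h hc hx' hxc') hb hbc)
  obtain ⟨k, hk⟩ := exists_δ_eq (D := D) y' q
  have hyk : D.δ y k = w :=
    δ_jw h (δ_iu h (δ_jv h hk hxy'.symm hyx'.symm) hxx'.symm hne) hxy hyx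
  obtain ⟨m, hkm, hmk, hym⟩ := exists_δ_u' h hyk
  have hym' : D.δ y' m = r := δ_rj' h hk hkm hmk
  have hxm' : D.δ x' m = t := δ_iu h.symm hym' hxy'.symm hyx'.symm
  have hxm : D.δ x m = w := δ_jw h.symm hxm' hxx'.symm hne
  have hcm : D.δ c₂ m = w := δ_jw h.symm hxm' (Adj.symm hx') (Ne.symm hxc')
  obtain ⟨e, hme, hem, hce⟩ := exists_δ_u' h.symm hcm
  have hye' : D.δ y' e = u := δ_ui' h hym' hme hem
  -- The alternative would make x, like `c₂`, the projection of e to the i-panel.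
  have hye : D.δ y e = u := by
    rcases right_cases hym hme with h1 | h1
    · exact h1
    · rw [h.ui] at h1
      have h2 : D.δ x e = t := δ_iu h.symm h1 hxy.symm hyx.symm
      exact absurd (eq_of_δ_u h.symm hce hx (by rw [h2, h.ht])) hxc
  have hsol : ∀ z, D.Adj i c₂ z → z ≠ c₂ → ∃ y, D.Adj j z y ∧ cs.length (D.δ y e) ≤ n + 2 ∧
      (∀ y', D.Adj j z y' → cs.length (D.δ y' e) ≤ n + 2 → y' = y) ∧ D.δ y c₀ = w := by
    intro z hz hzc
    obtain ⟨y, hy, hyz, hye⟩ := exists_δ_u h (δ_jw h.symm hce hz hzc)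
    exact ⟨y, hy, by rw [hye, h.hu], fun y' hy' hl => eq_of_δ_u h hye (hy.symm.trans hy') hl,
      δ_jw h (δ_iu h hc hz hzc) hy hyz⟩
  -- The composite of two projections: z goes to the projection y of e, then to the projection of y
  -- to the j'-panel of `c₀`. It is single-valued on the i-panel away from `c₂`, so it maps K to a
  -- connected set joining a to b.
  let R : C → C → Prop := fun z p => ∃ y, D.Adj j z y ∧ cs.length (D.δ y e) ≤ n + 2 ∧
    D.Adj j' c₀ p ∧ cs.length (D.δ y p) ≤ n + 2
  have hR : IsClosed {s : C × C | R s.1 s.2} := by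
    refine isClosed_setOf_exists ?_
    exact (hD.isClosed j (by fun_prop) (by fun_prop)).and
      ((hD.isClosed_length_le _ (by fun_prop) (by fun_prop)).and
      ((hD.isClosed j' (by fun_prop) (by fun_prop)).and
      (hD.isClosed_length_le _ (by fun_prop) (by fun_prop))))
  have hK' : IsPreconnected (Subtype.val '' K) := hK.image _ continuous_subtype_val.continuousOn
  refine ⟨{s | ∃ z ∈ Subtype.val '' K, R z s}, ?_,
    ⟨x, ⟨_, hxK, rfl⟩, y, hxy, by rw [hye, h.hu], ha, by rw [hya, h.hu]⟩,
    ⟨x', ⟨_, hxK', rfl⟩, y', hxy', by rw [hye', h.hu], hb, by rw [hyb, h.hu]⟩,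
    hK'.image_of_isClosed_rel hR ?_⟩
  · rintro s ⟨z, -, y, -, -, hs, -⟩
    exact hs
  · rintro _ ⟨⟨z, hz⟩, hzK, rfl⟩
    obtain ⟨y, hy, hye, hyu, hyc⟩ := hsol z hz (hKc _ hzK)
    obtain ⟨s, hs, -, hys⟩ := exists_δ_u' h hyc
    refine ⟨s, ⟨y, hy, hye, hs, by rw [hys, h.hu]⟩, ?_⟩
    rintro s' ⟨y', hy', hye', hs', hl⟩
    rw [hyu y' hy' hye'] at hl
    exact eq_of_δ_u' h hys (hs.symm.trans hs') hl

theorem ClosedAdj.isPreconnected_panel_of_not_commute (hD : D.ClosedAdj) [Finite W]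
    (hij : ¬ Commute (cs.simple i) (cs.simple j))
    (hS : ∀ c, HasPuncturedContinuum (D.panel i c) c) (c : C) : IsPreconnected (D.panel j c) := by
  obtain ⟨i', j', w, u, t, v, r, q, p, n, h⟩ := cs.exists_rankTwo hij
  obtain ⟨d, hd⟩ := exists_δ_eq (D := D) c u
  have hpre : IsPreconnected (D.panel j' d) := by
    refine isPreconnected_of_forall_pair fun a ha b hb => ?_
    -- Thickness provides a base point of the panel different from both a and b.
    obtain ⟨c₀, hc₀, hca, hcb⟩ := exists_adj_ne_ne (D := D) j' a b
    have hac : D.Adj j' d c₀ := Adj.trans ha hc₀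
    rw [← panel_eq (D := D) hac]
    exact hD.exists_isPreconnected_of_ne h hS hc₀.symm (hac.symm.trans hb) hca.symm hcb.symm
  obtain ⟨e, -⟩ := hD.exists_homeomorph (i := j) (k := j') (by rw [h.ju, h.uj])
    (by rw [h.ju, h.hu, h.hw]; omega) hd
  have := isPreconnected_iff_preconnectedSpace.mp hpre
  rw [isPreconnected_iff_preconnectedSpace]
  exact ⟨by rw [← e.symm.surjective.range_eq]; exact isPreconnected_range e.symm.continuous⟩

theorem ClosedAdj.preconnected_or_totallyDisconnected (hD : D.ClosedAdj) [Finite W] [Nontrivial B]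
    (hirr : cs.IsIrreducible) : PreconnectedSpace C ∨ TotallyDisconnectedSpace C := by
  have hirr' := hirr.exists_not_commute
  by_cases hp : ∀ i c, ∀ K ⊆ D.panel i c, IsPreconnected K → K.Subsingleton
  · exact Or.inr (hD.totallyDisconnectedSpace hp)
  left
  push Not at hp
  obtain ⟨i, c, K, hKs, hK, hn⟩ := hp
  have hi : ∀ d, HasPuncturedContinuum (D.panel i d) d := by
    suffices h : ∃ c, HasPuncturedContinuum (D.panel i c) c by
      obtain ⟨c, hc⟩ := h
      exact fun d => (hD.hasPuncturedContinuum_iff hirr' i c d).mp hc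
    -- If K misses a point, take it as base point. If K is the whole panel, a proper nontrivial
    -- connected subset is found by cutting out c.
    by_cases hall : D.panel i c ⊆ K
    · refine ⟨c, hD.hasPuncturedContinuum_of_isPreconnected ?_⟩
      rwa [Subset.antisymm hall hKs]
    · obtain ⟨c₂, hc₂, hcK⟩ := not_subset.mp hall
      refine ⟨c₂, ?_⟩
      rw [panel_eq hc₂]
      have himg : (Subtype.val : D.panel i c → C) '' (Subtype.val ⁻¹' K) = K := by
        rw [Subtype.image_preimage_coe, inter_eq_right.mpr hKs]
      refine ⟨Subtype.val ⁻¹' K, ?_, ?_, fun x hx hxc => hcK (hxc ▸ hx)⟩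
      · rw [← IsInducing.subtypeVal.isPreconnected_image, himg]
        exact hK
      · obtain ⟨x, hx, y, hy, hxy⟩ := hn
        exact ⟨⟨x, hKs hx⟩, hx, ⟨y, hKs hy⟩, hy, fun h => hxy (congrArg Subtype.val h)⟩
  have hall : ∀ k, ∀ d, HasPuncturedContinuum (D.panel k d) d := by
    by_contra! hcon
    obtain ⟨k, d, hk⟩ := hcon
    obtain ⟨a, ha, b, hb, hab⟩ := hirr {k | ∀ d, HasPuncturedContinuum (D.panel k d) d} ⟨i, hi⟩
      ⟨k, fun h => hk (h d)⟩
    exact hb fun d => hD.hasPuncturedContinuum_of_isPreconnected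
      (hD.isPreconnected_panel_of_not_commute hab ha d)
  refine preconnectedSpace_of_panels (D := D) fun k d => ?_
  obtain ⟨j, hj⟩ := hirr' k
  exact hD.isPreconnected_panel_of_not_commute (fun h => hj h.symm) (hall j) d

end WeylDistance

/-! ### Infinite panels: accumulation points and countable bases. -/

namespace WeylDistance

open Set Topology TopologicalSpace

variable {B W C : Type*} [Group W] {M : CoxeterMatrix B} {cs : CoxeterSystem M W}
  {D : WeylDistance cs C} {i j k i' j' : B} {c d x y z : C} {g w u t v r q p : W} {n : ℕ}

/-- A point of a set is an accumulation point of a countable subset of it. -/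
def IsCountableAccPt [TopologicalSpace C] (P : Set C) (c : C) : Prop :=
  ∃ S : Set P, S.Countable ∧ (∀ x ∈ S, x.1 ≠ c) ∧ c ∈ closure (Subtype.val '' S)

variable [TopologicalSpace C] [CompactSpace C]

theorem ClosedAdj.exists_isCountableAccPt (hD : D.ClosedAdj) (h : (D.panel i c).Infinite) :
    ∃ d, IsCountableAccPt (D.panel i d) d := by
  have : CompactSpace (D.panel i c) :=
    isCompact_iff_compactSpace.mp (hD.isClosed_panel i c).isCompact
  have : Infinite (D.panel i c) := h.to_subtype
  let f := Infinite.natEmbedding (D.panel i c)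
  have hf : (range f).Infinite := infinite_range_of_injective f.injective
  obtain ⟨⟨d, hd⟩, hacc⟩ := hf.exists_accPt_principal
  refine ⟨d, ?_⟩
  rw [panel_eq hd]
  refine ⟨range f \ {⟨d, hd⟩}, (countable_range f).mono sdiff_subset,
    fun x hx hxd => hx.2 (Subtype.ext hxd), ?_⟩
  rw [accPt_principal_iff_clusterPt, ← mem_closure_iff_clusterPt] at hacc
  exact closure_subtype.mp hacc

variable [T2Space C] [Finite B]

theorem ClosedAdj.isCountableAccPt_iff_of_δ_eq (hD : D.ClosedAdj)
    (ht : cs.simple i * t = t * cs.simple k) (hl : cs.length t < cs.length (cs.simple i * t))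
    (hcd : D.δ c d = t) :
    IsCountableAccPt (D.panel i c) c ↔ IsCountableAccPt (D.panel k d) d := by
  have key : ∀ (P Q : Set C) (c d : C) (hc : c ∈ P) (hd : d ∈ Q) (e : P ≃ₜ Q),
      e ⟨c, hc⟩ = ⟨d, hd⟩ → IsCountableAccPt P c → IsCountableAccPt Q d := by
    rintro P Q c d hc hd e he ⟨S, hS, hSc, hcl⟩
    refine ⟨e '' S, hS.image _, ?_, ?_⟩
    · rintro _ ⟨x, hx, rfl⟩ hxd
      have h1 : e x = e ⟨c, hc⟩ := by rw [he]; exact Subtype.ext hxd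
      exact hSc x hx (congrArg Subtype.val (e.injective h1))
    · have h1 : (⟨c, hc⟩ : P) ∈ closure S := closure_subtype.mpr hcl
      have h2 : (⟨d, hd⟩ : Q) ∈ closure (e '' S) := by
        rw [← he, ← e.image_closure]
        exact mem_image_of_mem _ h1
      exact closure_subtype.mp h2
  obtain ⟨e, he⟩ := hD.exists_homeomorph ht hl hcd
  exact ⟨key _ _ _ _ _ _ e he, key _ _ _ _ _ _ e.symm (by rw [← he, e.symm_apply_apply])⟩

theorem ClosedAdj.isCountableAccPt_iff (hD : D.ClosedAdj) [Finite W]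
    (hirr : ∀ i : B, ∃ j, ¬ Commute (cs.simple i) (cs.simple j)) (i : B) (c d : C) :
    IsCountableAccPt (D.panel i c) c ↔ IsCountableAccPt (D.panel i d) d :=
  homogeneous (D := D) (S := fun i c => IsCountableAccPt (D.panel i c) c) hirr
    (fun _ _ _ _ _ ht hl hcd => hD.isCountableAccPt_iff_of_δ_eq ht hl hcd) i c d

theorem ClosedAdj.isCountableAccPt_opposite (hD : D.ClosedAdj)
    (h : cs.RankTwo i j i' j' w u t v r q p n)
    (hi : ∀ c, IsCountableAccPt (D.panel i c) c) (d : C) : IsCountableAccPt (D.panel i' d) d := by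
  obtain ⟨c, hc⟩ := exists_δ_eq' (D := D) d t
  exact (hD.isCountableAccPt_iff_of_δ_eq (by rw [h.it, h.ti]) (by rw [h.it, h.ht, h.hw]; omega)
    hc).mp (hi c)

/-- If the panels of a type are not discrete, then the panels of each adjacent type are
infinite. -/
theorem ClosedAdj.infinite_panel (hD : D.ClosedAdj) [Finite W]
    (h : cs.RankTwo i j i' j' w u t v r q p n)
    (hi : ∀ c, IsCountableAccPt (D.panel i c) c) (x : C) : (D.panel j x).Infinite := by
  have hi' := hD.isCountableAccPt_opposite h hi
  intro hfin
  obtain ⟨w₀, hw₀⟩ := cs.exists_isLongest univ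
  obtain ⟨e₁, he₁⟩ := exists_δ_eq (D := D) x r
  obtain ⟨e₂, h12, hne2, he₂⟩ := exists_right he₁ j'
  rw [h.rj] at he₂
  obtain ⟨m, hm1, hme1, hme2⟩ := exists_adj_ne_ne (D := D) j' e₁ e₂
  have hxm : D.δ x m = r := δ_rj' h he₂ (h12.symm.trans hm1) hme2
  obtain ⟨g, hg⟩ : ∃ g, cs.simple j' * g = w₀ := ⟨cs.simple j' * w₀, by simp⟩
  have hgl : cs.length g + 1 = cs.length w₀ := by
    have := hw₀.left (cs.simple j') (cs.simple_mem_parabolic (mem_univ _))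
    rwa [← hg, cs.simple_mul_simple_cancel_left, cs.length_simple, hg] at this
  obtain ⟨k, hk⟩ := exists_δ_eq (D := D) m g
  have hlg : cs.length g < cs.length (cs.simple j' * g) := by rw [hg]; omega
  have hek : D.δ e₁ k = w₀ := (left_up hk hlg hm1.symm hme1.symm).trans hg
  have hO : IsOpen (D.panel j x \ {x})ᶜ := (hfin.subset sdiff_subset).isClosed.isOpen_compl
  -- For s = (b, b', y): b is the projection of k to the j'-panel of a, b' is i'-adjacent to b, and
  -- y ≠ x is in the j-panel of x and close to b'. Such y exists for a ≠ e₁ near e₁ in the i'-panel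
  -- of e₁, but at e₁ itself it would have to be x. If the panel were finite, its part without x
  -- would be closed and so would be this condition on a, a contradiction.
  let T : C → C × C × C → Prop := fun a s => D.Adj j' a s.1 ∧ cs.length (D.δ s.1 k) ≤ cs.length g ∧
    D.Adj i' s.1 s.2.1 ∧ cs.length (D.δ s.2.2 s.2.1) ≤ n + 1 ∧ s.2.2 ∈ D.panel j x \ {x}
  have hT : IsClosed {a | ∃ s, T a s} := by
    refine isClosed_setOf_exists ?_
    exact (hD.isClosed j' (by fun_prop) (by fun_prop)).and
      ((hD.isClosed_length_le _ (by fun_prop) (by fun_prop)).and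
      ((hD.isClosed i' (by fun_prop) (by fun_prop)).and
      ((hD.isClosed_length_le _ (by fun_prop) (by fun_prop)).and
      ((hfin.subset sdiff_subset).isClosed.preimage (by fun_prop)))))
  have hnot : e₁ ∉ {a | ∃ s, T a s} := by
    -- At `e₁` the projection of k is m, which has distance r from x. Any y ≠ x then has distance t
    -- from m, and distance t or w from every chamber of the i'-panel of m.
    rintro ⟨⟨m', b, y⟩, h1, h2, h3, h4, h5, h6⟩
    dsimp only at h1 h2 h3 h4 h5 h6
    have hm' : m' = m := left_unique hk hlg (hm1.symm.trans h1) (by omega)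
    subst hm'
    have hy : D.δ y m' = t := δ_iu h.symm hxm h5 h6
    rcases right_cases hy h3 with h7 | h7
    · rw [h7, h.ht] at h4; omega
    · rw [h7, h.ti, h.hw] at h4; omega
  have hnhds : {a | ∃ s, T a s}ᶜ ∩ {a | D.δ a k = w₀} ∈ 𝓝 e₁ :=
    (hT.isOpen_compl.inter (hD.isOpen_δ_eq hw₀ continuous_id continuous_const)).mem_nhds
      ⟨hnot, hek⟩
  obtain ⟨S, -, hSe, hcl⟩ := hi' e₁
  obtain ⟨_, ⟨haT, hak⟩, ⟨a, ha⟩, haS, rfl⟩ := mem_closure_iff_nhds.mp hcl _ hnhds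
  have hae := hSe _ haS
  apply haT
  have hxa : D.δ x a = u := δ_ui' h he₁ ha hae
  have hak' : D.δ a k = cs.simple j' * g := hg ▸ hak
  obtain ⟨b, hab, hba, hbk⟩ := exists_left hak' j'
  rw [cs.simple_mul_simple_cancel_left] at hbk
  have hxb : D.δ x b = w := δ_wj' h hxa hab hba
  obtain ⟨y, hxy, hyx, hyb⟩ := exists_δ_u h hxb
  obtain ⟨s, hbs, -, hys⟩ := exists_right hyb i'
  rw [h.ui] at hys
  exact ⟨⟨b, s, y⟩, hab, by rw [hbk], hbs, by rw [hys, h.hr], hxy, hyx⟩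

theorem ClosedAdj.isCountableAccPt_of_infinite (hD : D.ClosedAdj) [Finite W] [Nontrivial B]
    (hirr : cs.IsIrreducible) (hinf : (D.panel i c).Infinite) (j : B) (d : C) :
    IsCountableAccPt (D.panel j d) d := by
  have hirr' := hirr.exists_not_commute
  have key : ∀ i c, (D.panel i c).Infinite → ∀ d, IsCountableAccPt (D.panel i d) d := by
    intro i c h d
    obtain ⟨c', hc'⟩ := hD.exists_isCountableAccPt h
    exact (hD.isCountableAccPt_iff hirr' i c' d).mp hc'
  revert j d
  by_contra! hcon
  obtain ⟨k, d, hk⟩ := hcon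
  obtain ⟨a, ha, b, hb, hab⟩ := hirr {k | ∀ d, IsCountableAccPt (D.panel k d) d}
    ⟨i, key i c hinf⟩ ⟨k, fun h => hk (h d)⟩
  obtain ⟨i', j', w, u, t, v, r, q, p, n, h⟩ := cs.exists_rankTwo hab
  exact hb (key b d (hD.infinite_panel h ha d))

/-- In a thick compact building with infinite panels, all panels are second countable. -/
theorem ClosedAdj.secondCountableTopology_panel (hD : D.ClosedAdj)
    (h : cs.RankTwo i j i' j' w u t v r q p n)
    (hi : ∀ c, IsCountableAccPt (D.panel i c) c) (c : C) :
    SecondCountableTopology (D.panel i c) := by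
  have hi' := hD.isCountableAccPt_opposite h hi
  have : CompactSpace (D.panel i c) :=
    isCompact_iff_compactSpace.mp (hD.isClosed_panel i c).isCompact
  obtain ⟨c', hc', hne, -⟩ := exists_adj_ne_ne (D := D) i c c
  refine secondCountableTopology_of_punctured_diagonal (c := (⟨c, mem_panel_self i c⟩ : D.panel i c))
    (d := ⟨c', hc'⟩) (fun h => hne (congrArg Subtype.val h).symm) ?_
  rintro ⟨c₂, hc₂⟩
  obtain ⟨ζ₀, hζ₀⟩ := exists_δ_eq (D := D) c₂ p
  obtain ⟨S, hS, hSζ, hcl⟩ := hi' ζ₀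
  obtain ⟨c₀, hζc', hcζ, -⟩ := exists_adj_ne_ne (D := D) i' ζ₀ ζ₀
  obtain ⟨b, hcb, hbc, -⟩ := exists_adj_ne_ne (D := D) j' c₀ c₀
  obtain ⟨g, hcg, hgc, hgb⟩ := exists_adj_ne_ne (D := D) j' c₀ b
  have hc20 : D.δ c₂ c₀ = v := δ_rj' h.symm hζ₀ hζc' hcζ
  obtain ⟨V, V', hV, hV', hbV, hcV', hVV'⟩ := t2_separation hbc
  have hcV : c₀ ∉ closure V := fun hcl =>
    (hVV'.closure_left hV').le_bot ⟨hcl, hcV'⟩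
  -- Successive projections: `y₀` of b to the j-panel of `a₀`, a of ζ to the i-panel of `y₀`, e' of
  -- a to the i'-panel of g, and e of a to the j'-panel of e'. So ζ and `a₀` determine e.
  let U : C → C → C → C → C → C → Prop := fun ζ a₀ y₀ a e' e =>
    (D.Adj j a₀ y₀ ∧ cs.length (D.δ y₀ b) ≤ n + 2) ∧ (D.Adj i y₀ a ∧ cs.length (D.δ a ζ) ≤ n + 2) ∧
    (D.Adj i' g e' ∧ cs.length (D.δ a e') ≤ n + 2) ∧ (D.Adj j' e' e ∧ cs.length (D.δ a e) ≤ n + 1)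
  -- As in the connectivity argument, s is the image of x under projection of e to the j-panel of x,
  -- followed by projection to the j'-panel of `c₀`. Call it F(ζ, a₀, x). Then F(ζ₀, a₀, x) = c₀ for
  -- x ≠ a₀, whereas F(ζ, a₀, a₀) = b for ζ ≠ ζ₀. A closed relation replaces the function since
  -- values need not be unique everywhere.
  let T : C → C → C → C → C × C × C × C × C → Prop := fun ζ a₀ x s f =>
    U ζ a₀ f.1 f.2.1 f.2.2.1 f.2.2.2.1 ∧
    (D.Adj j x f.2.2.2.2 ∧ cs.length (D.δ f.2.2.2.2 f.2.2.2.1) ≤ n + 2) ∧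
    (D.Adj j' c₀ s ∧ cs.length (D.δ f.2.2.2.2 s) ≤ n + 2)
  have hT : IsClosed {s : C × C × C × C | ∃ f, T s.1 s.2.1 s.2.2.1 s.2.2.2 f} := by
    refine isClosed_setOf_exists ?_
    refine IsClosed.and (IsClosed.and ?_ (IsClosed.and ?_ (IsClosed.and ?_ ?_)))
      (IsClosed.and ?_ ?_)
      <;> exact (hD.isClosed _ (by fun_prop) (by fun_prop)).and
        (hD.isClosed_length_le _ (by fun_prop) (by fun_prop))
  have hU : ∀ ζ, D.Adj i' ζ₀ ζ → ζ ≠ c₀ → ∀ a₀, D.Adj i c₂ a₀ → a₀ ≠ c₂ → ∃ y₀ a e' e,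
      U ζ a₀ y₀ a e' e ∧ (∀ y₁ a₁ e₁' e₁, U ζ a₀ y₁ a₁ e₁' e₁ → e₁ = e) ∧
      y₀ ≠ a₀ ∧ D.δ y₀ b = u ∧ (ζ = ζ₀ → a = y₀) ∧ (ζ ≠ ζ₀ → a ≠ y₀) ∧ D.δ a e = v := by
    intro ζ hζ hζc a₀ ha₀ hac
    have ha₀c : D.δ a₀ c₀ = u := δ_iu h hc20 ha₀ hac
    obtain ⟨y₀, hy₀, hya, hyb⟩ := exists_δ_u h (δ_wj' h ha₀c hcb hbc)
    have hyg : D.δ y₀ g = w := δ_wj' h hyb (hcb.symm.trans hcg) hgb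
    have hyζ : D.δ y₀ ζ₀ = t := δ_iu h.symm (δ_jv h.symm hζ₀ ha₀ hac) hy₀ hya
    obtain ⟨a, hya', haζ, hag, ha1, ha2⟩ : ∃ a, D.Adj i y₀ a ∧ D.δ a ζ = t ∧ D.δ a g = w ∧
        (ζ = ζ₀ → a = y₀) ∧ (ζ ≠ ζ₀ → a ≠ y₀) := by
      by_cases hζζ : ζ = ζ₀
      · exact ⟨y₀, Adj.refl i y₀, hζζ ▸ hyζ, hyg, fun _ => rfl, fun h => absurd hζζ h⟩
      · obtain ⟨a, ha, hay, haζ⟩ := exists_δ_u h.symm (δ_wj' h.symm hyζ hζ hζζ)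
        refine ⟨a, ha, haζ, ?_, fun h => absurd h hζζ, fun _ => hay⟩
        have hac₀ : D.δ a c₀ = w := δ_wj' h.symm haζ (hζ.symm.trans hζc') hζc.symm
        -- If neither side gave w, the distance from a to g would be both u and t, forcing w = v.
        rcases right_cases hac₀ hcg with h1 | h1
        · exact h1
        rcases left_cases hyg ha with h2 | h2
        · exact h2
        rw [h.wj] at h1
        rw [h.iw, h1] at h2
        have h3 := h.symm.ju
        rw [← h2, ← h.iv, cs.simple_mul_simple_cancel_left] at h3
        have h4 := h.hw
        rw [← h3, h.hv] at h4
        omega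
    obtain ⟨e', hge, -, hae'⟩ := exists_δ_u' h.symm hag
    obtain ⟨e, hee, -, hae⟩ := exists_right hae' j'
    rw [h.tj] at hae
    refine ⟨y₀, a, e', e, ⟨⟨hy₀, by rw [hyb, h.hu]⟩, ⟨hya', by rw [haζ, h.ht]⟩,
      ⟨hge, by rw [hae', h.ht]⟩, hee, by rw [hae, h.hv]⟩, ?_, hya, hyb, ha1, ha2, hae⟩
    rintro y₁ a₁ e₁' e₁ ⟨⟨h1, h1'⟩, ⟨h2, h2'⟩, ⟨h3, h3'⟩, h4, h4'⟩
    obtain rfl := eq_of_δ_u h hyb (hy₀.symm.trans h1) h1'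
    obtain rfl := eq_of_δ_u h.symm haζ (hya'.symm.trans h2) h2'
    obtain rfl := eq_of_δ_u' h.symm hae' (hge.symm.trans h3) h3'
    exact right_unique hae (by rw [h.vj, h.hv, h.ht]; omega) (hee.symm.trans h4)
      (by rw [h.vj, h.ht]; omega)
  have hF1 : ∀ a₀ x, D.Adj i c₂ a₀ → a₀ ≠ c₂ → D.Adj i c₂ x → x ≠ c₂ → a₀ ≠ x →
      ∀ s f, T ζ₀ a₀ x s f → s = c₀ := by
    rintro a₀ x ha₀ hac hx hxc hax s ⟨y₁, a₁, e₁', e₁, y⟩ ⟨hU1, ⟨h1, h1'⟩, h2, h2'⟩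
    dsimp only at hU1 h1 h1' h2 h2'
    obtain ⟨y₀, a, e', e, ⟨⟨hy, -⟩, -, ⟨hge, -⟩, hee, -⟩, hun, hya, -, ha1, -, hae⟩ :=
      hU ζ₀ (Adj.refl i' ζ₀) hcζ.symm a₀ ha₀ hac
    obtain rfl := hun _ _ _ _ hU1
    -- Now `y₀` has distance v from `e₁`. As `a₀` is opposite g in the rank two sense, it is not the
    -- projection of `e₁` to its j-panel, so x ≠ a₀ has distance u from `e₁` and is itself the
    -- projection.
    rw [ha1 rfl] at hae
    have hag : D.δ a₀ g = w := δ_wj' h (δ_iu h hc20 ha₀ hac) hcg hgc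
    obtain ⟨m, hym, -, hme⟩ := exists_left hae j
    rw [h.jv] at hme
    have hma : a₀ ≠ m := by
      rintro rfl
      have h3 := length_δ_le_succ (c := a₀) hee.symm
      have h4 := length_δ_le_succ (c := a₀) hge.symm
      rw [hme, h.hq] at h3
      rw [hag, h.hw] at h4
      omega
    have hxe : D.δ x e₁ = u := δ_iu h (δ_jv h hme (hym.symm.trans hy.symm) hma)
      ((Adj.symm ha₀).trans hx) hax.symm
    obtain rfl := eq_of_δ_u h hxe h1 h1'
    exact eq_of_δ_u' h (δ_iu h hc20 hx hxc) h2 h2'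
  have hF2 : ∀ ζ, D.Adj i' ζ₀ ζ → ζ ≠ ζ₀ → ζ ≠ c₀ → ∀ a₀, D.Adj i c₂ a₀ → a₀ ≠ c₂ →
      ∀ s f, T ζ a₀ a₀ s f → s = b := by
    rintro ζ hζ hζζ hζc a₀ ha₀ hac s ⟨y₁, a₁, e₁', e₁, y⟩ ⟨hU1, ⟨h1, h1'⟩, h2, h2'⟩
    dsimp only at hU1 h1 h1' h2 h2'
    obtain ⟨y₀, a, e', e, ⟨⟨hy, -⟩, ⟨hya', -⟩, -⟩, hun, hya, hyb, -, ha2, hae⟩ :=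
      hU ζ hζ hζc a₀ ha₀ hac
    obtain rfl := hun _ _ _ _ hU1
    have hye : D.δ y₀ e₁ = u := δ_iu h hae hya'.symm (ha2 hζζ).symm
    obtain rfl := eq_of_δ_u h hye (hy.symm.trans h1) h1'
    exact eq_of_δ_u' h hyb (hcb.symm.trans h2) h2'
  have hF3 : ∀ ζ, D.Adj i' ζ₀ ζ → ζ ≠ ζ₀ → ζ ≠ c₀ → ∀ a₀ x, D.Adj i c₂ a₀ → a₀ ≠ c₂ →
      D.Adj i c₂ x → x ≠ c₂ → ∃ s f, T ζ a₀ x s f := by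
    intro ζ hζ hζζ hζc a₀ x ha₀ hac hx hxc
    obtain ⟨y₀, a, e', e, hUe, -, hya, -, -, ha2, hae⟩ := hU ζ hζ hζc a₀ ha₀ hac
    have hye : D.δ y₀ e = u := δ_iu h hae hUe.2.1.1.symm (ha2 hζζ).symm
    have hae' : D.δ a₀ e = w := δ_jw h hye hUe.1.1.symm hya.symm
    obtain ⟨y, hxy, hyl⟩ : ∃ y, D.Adj j x y ∧ cs.length (D.δ y e) ≤ n + 2 := by
      rcases left_cases hae' ((Adj.symm ha₀).trans hx) with h1 | h1
      · obtain ⟨y, hy, -, hye⟩ := exists_δ_u h h1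
        exact ⟨y, hy, by rw [hye, h.hu]⟩
      · exact ⟨x, Adj.refl j x, by rw [h1, h.iw, h.ht]⟩
    have hxc₀ : D.δ x c₀ = u := δ_iu h hc20 hx hxc
    obtain ⟨s, hs, hys⟩ : ∃ s, D.Adj j' c₀ s ∧ cs.length (D.δ y s) ≤ n + 2 := by
      by_cases hyx : y = x
      · exact ⟨c₀, Adj.refl j' c₀, by rw [hyx, hxc₀, h.hu]⟩
      · obtain ⟨s, hs, -, hys⟩ := exists_δ_u' h (δ_jw h hxc₀ hxy hyx)
        exact ⟨s, hs, by rw [hys, h.hu]⟩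
    exact ⟨s, ⟨y₀, a, e', e, y⟩, hUe, ⟨hxy, hyl⟩, hs, hys⟩
  -- The open sets are indexed by ζ in S: those pairs all of whose values F(ζ, ·, ·) lie in the
  -- neighborhood V of b. They contain the diagonal off `c₂`. For `a₀` ≠ x the values avoid the
  -- closure of V as soon as ζ is near `ζ₀`, and a value exists, so some ζ excludes the pair.
  refine ⟨(fun ζ : D.panel i' ζ₀ => {s : D.panel i c × D.panel i c |
    ∃ p, p ∈ Vᶜ ∧ ∃ f, T ζ s.1 s.2 p f}ᶜ) '' (S \ {⟨c₀, hζc'⟩}), (hS.mono sdiff_subset).image _,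
    ?_, ?_, ?_⟩
  · rintro _ ⟨ζ, -, rfl⟩
    rw [isOpen_compl_iff]
    refine isClosed_setOf_exists ?_
    exact (hV.isClosed_compl.preimage continuous_snd).and
      (hT.preimage (f := fun q : (D.panel i c × D.panel i c) × C => (ζ.1, q.1.1.1, q.1.2.1, q.2))
        (by fun_prop))
  · rintro _ ⟨ζ, hζS, rfl⟩ ⟨x, hx⟩ hxc ⟨p, hpV, f, hf⟩
    have hζc : ζ.1 ≠ c₀ := fun h => hζS.2 (Subtype.ext h)
    have hpb := hF2 ζ ζ.2 (hSζ ζ hζS.1) hζc x ((Adj.symm hc₂).trans hx)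
      (fun h => hxc (Subtype.ext h)) p f hf
    exact hpV (hpb ▸ hbV)
  · rintro ⟨a₀, ha₀⟩ ⟨x, hx⟩ hac hxc hne
    have ha₀' : D.Adj i c₂ a₀ := (Adj.symm hc₂).trans ha₀
    have hx' : D.Adj i c₂ x := (Adj.symm hc₂).trans hx
    have hac' : a₀ ≠ c₂ := fun h => hac (Subtype.ext h)
    have hxc' : x ≠ c₂ := fun h => hxc (Subtype.ext h)
    have hcl' : IsClosed {ζ | ∃ p, p ∈ closure V ∧ ∃ f, T ζ a₀ x p f} := by
      refine isClosed_setOf_exists ?_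
      exact (isClosed_closure.preimage continuous_snd).and
        (hT.preimage (f := fun q : C × C => (q.1, a₀, x, q.2)) (by fun_prop))
    have hnot : ζ₀ ∉ {ζ | ∃ p, p ∈ closure V ∧ ∃ f, T ζ a₀ x p f} := by
      rintro ⟨p, hp, f, hf⟩
      exact hcV (hF1 a₀ x ha₀' hac' hx' hxc' (fun h => hne (Subtype.ext h)) p f hf ▸ hp)
    obtain ⟨_, ⟨h1, h2⟩, ζ, hζS, rfl⟩ := mem_closure_iff_nhds.mp hcl _
      ((hcl'.isOpen_compl.inter isOpen_ne).mem_nhds ⟨hnot, hcζ.symm⟩)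
    obtain ⟨p, f, hf⟩ := hF3 ζ ζ.2 (hSζ ζ hζS) h2 a₀ x ha₀' hac' hx' hxc'
    refine ⟨_, ⟨ζ, ⟨hζS, fun h => h2 (congrArg Subtype.val h)⟩, rfl⟩, fun hn => hn ⟨p, ?_, f, hf⟩⟩
    exact fun hpV => h1 ⟨p, subset_closure hpV, f, hf⟩

end WeylDistance

/-! ### From panels to the whole chamber set. -/

theorem secondCountableTopology_iUnion {ι X : Type*} [Finite ι] [TopologicalSpace X] [T2Space X]
    {K : ι → Set X} (hK : ∀ i, IsCompact (K i)) (hs : ∀ i, SecondCountableTopology (K i)) :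
    SecondCountableTopology (⋃ i, K i : Set X) := by
  have : ∀ i, CompactSpace (K i) := fun i => isCompact_iff_compactSpace.mp (hK i)
  refine secondCountableTopology_of_surjective
    (f := fun p : Σ i, K i => (⟨p.2.1, Set.mem_iUnion.mpr ⟨p.1, p.2.2⟩⟩ : (⋃ i, K i : Set X)))
    ?_ ?_
  · exact Continuous.subtype_mk (continuous_sigma fun i => continuous_subtype_val) _
  · rintro ⟨x, hx⟩
    obtain ⟨i, hi⟩ := Set.mem_iUnion.mp hx
    exact ⟨⟨i, x, hi⟩, rfl⟩

namespace WeylDistance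

open Set Topology TopologicalSpace

variable {B W C : Type*} [Group W] {M : CoxeterMatrix B} {cs : CoxeterSystem M W}
  {D : WeylDistance cs C} {i : B} {c d x y z : C} {g w : W} {n : ℕ}

theorem ball_zero (c : C) : {d | cs.length (D.δ c d) ≤ 0} = {c} := by
  ext d
  rw [mem_ofPred_eq, nonpos_iff_eq_zero, cs.length_eq_zero_iff, D.eq_one_iff, mem_singleton_iff,
    eq_comm]

theorem ball_succ (c : C) (n : ℕ) : {d | cs.length (D.δ c d) ≤ n + 1} =
    {d | cs.length (D.δ c d) ≤ n} ∪
      ⋃ i, {d | ∃ z ∈ {z | cs.length (D.δ c z) ≤ n}, D.Adj i z d} := by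
  ext d
  simp only [mem_ofPred_eq, length_δ_le_succ_iff, mem_union, mem_iUnion]

theorem exists_ball_eq_univ [Finite W] (D : WeylDistance cs C) (c : C) :
    ∃ n, {d | cs.length (D.δ c d) ≤ n} = univ := by
  obtain ⟨n, hn⟩ := (Set.finite_range cs.length).bddAbove
  exact ⟨n, eq_univ_of_forall fun d => hn ⟨_, rfl⟩⟩

theorem finite_of_panels [Finite W] [Finite B] (h : ∀ i c, (D.panel i c).Finite) : Finite C := by
  rcases isEmpty_or_nonempty C with hC | ⟨⟨c⟩⟩
  · infer_instance
  obtain ⟨n, hn⟩ := D.exists_ball_eq_univ c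
  suffices H : ∀ n, {d | cs.length (D.δ c d) ≤ n}.Finite from finite_univ_iff.mp (hn ▸ H n)
  intro n
  induction n with
  | zero => rw [ball_zero]; exact finite_singleton c
  | succ n ih =>
    rw [ball_succ]
    refine ih.union (finite_iUnion fun i => (ih.biUnion fun z _ => h i z).subset ?_)
    rintro d ⟨z, hz, hzd⟩
    exact mem_biUnion hz hzd

variable [TopologicalSpace C] [CompactSpace C]

theorem ClosedAdj.isClosed_exists_adj (hD : D.ClosedAdj) {K : Set C} (hK : IsClosed K) (i : B) :
    IsClosed {z | ∃ c ∈ K, D.Adj i c z} :=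
  isClosed_setOf_exists ((hK.preimage continuous_snd).and
    (hD.isClosed i continuous_snd continuous_fst))

variable [T2Space C] [Finite B]

/-- Near each point of K, all chambers are opposite one fixed chamber o. There the i-panel of c is
swept out by projecting the chambers of a fixed panel of o, so the set is locally a continuous image
of K times that panel; compactness leaves finitely many pieces. -/
theorem ClosedAdj.secondCountableTopology_exists_adj (hD : D.ClosedAdj) [Finite W]
    (hp : ∀ i c, SecondCountableTopology (D.panel i c)) {K : Set C} (hK : IsClosed K)
    (hs : SecondCountableTopology K) (i : B) :
    SecondCountableTopology {z | ∃ c ∈ K, D.Adj i c z} := by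
  obtain ⟨w₀, hw₀⟩ := cs.exists_isLongest univ
  obtain ⟨k, -, hk⟩ := hw₀.exists_opposite (mem_univ i)
  obtain ⟨g, hg⟩ : ∃ g, cs.simple i * g = w₀ := ⟨cs.simple i * w₀, by simp⟩
  have hgk : g * cs.simple k = w₀ := by
    rw [← hg, mul_assoc] at hk
    rw [← mul_left_cancel hk, hg]
  have hl : cs.length g < cs.length w₀ := by
    have := hw₀.left (cs.simple i) (cs.simple_mem_parabolic (mem_univ _))
    rw [← hg, cs.simple_mul_simple_cancel_left, cs.length_simple, hg] at this
    omega
  have hli : cs.length g < cs.length (cs.simple i * g) := by rwa [hg]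
  have hlk : cs.length g < cs.length (g * cs.simple k) := by rwa [hgk]
  choose o ho using fun c : C => exists_δ_eq (D := D) c w₀
  have hF : ∀ c, ∃ F ∈ 𝓝 c, IsClosed F ∧ F ⊆ {x | D.δ x (o c) = w₀} := fun c =>
    exists_mem_nhds_isClosed_subset
      ((hD.isOpen_δ_eq hw₀ continuous_id continuous_const).mem_nhds (ho c))
  choose F hFc hFcl hFsub using hF
  obtain ⟨t, -, ht⟩ := hK.isCompact.elim_nhds_subcover F fun x _ => hFc x
  have hcov : {z | ∃ c ∈ K, D.Adj i c z} = ⋃ x : t, {z | ∃ c ∈ K ∩ F x, D.Adj i c z} := by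
    ext z
    simp only [mem_ofPred_eq, mem_iUnion]
    constructor
    · rintro ⟨c, hc, hcz⟩
      obtain ⟨x, hx, hcx⟩ := mem_iUnion₂.mp (ht hc)
      exact ⟨⟨x, hx⟩, c, ⟨hc, hcx⟩, hcz⟩
    · rintro ⟨x, c, hc, hcz⟩
      exact ⟨c, hc.1, hcz⟩
  rw [hcov]
  refine secondCountableTopology_iUnion
    (fun x => (hD.isClosed_exists_adj (hK.inter (hFcl x)) i).isCompact) fun x => ?_
  have hKF : CompactSpace (K ∩ F x : Set C) :=
    isCompact_iff_compactSpace.mp (hK.inter (hFcl x)).isCompact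
  have hKs : SecondCountableTopology (K ∩ F x : Set C) :=
    (Topology.IsEmbedding.inclusion inter_subset_left).secondCountableTopology
  have hpc : CompactSpace (D.panel k (o x)) :=
    isCompact_iff_compactSpace.mp (hD.isClosed_panel k (o x)).isCompact
  have hproj : ∀ p : (K ∩ F x : Set C) × D.panel k (o x), ∃ z, D.Adj i p.1 z ∧ D.δ z p.2 = g ∧
      ∀ z', D.Adj i p.1 z' → cs.length (D.δ z' p.2) ≤ cs.length g → z' = z := by
    rintro ⟨⟨c, hcK, hcF⟩, ⟨y, hy⟩⟩
    have h1 : D.δ c (o x) = g * cs.simple k := (hFsub x hcF).trans hgk.symm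
    refine existsUnique_left hli ?_
    rcases right_cases h1 hy with h2 | h2
    · right; rw [hg, h2, hgk]
    · left; rw [h2, cs.simple_mul_simple_cancel_right]
  choose f hf hfg hfu using hproj
  have hfc : Continuous f := continuous_of_isClosed_rel
    (R := fun p z => D.Adj i p.1 z ∧ cs.length (D.δ z p.2) ≤ cs.length g)
    ((hD.isClosed i (by fun_prop) (by fun_prop)).and
      (hD.isClosed_length_le _ (by fun_prop) (by fun_prop)))
    (fun p => ⟨hf p, (hfg p).symm ▸ le_rfl⟩) (fun p z hz => hfu p z hz.1 hz.2)
  refine secondCountableTopology_of_surjective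
    (f := fun p => (⟨f p, p.1, p.1.2, hf p⟩ : {z | ∃ c ∈ K ∩ F x, D.Adj i c z}))
    (hfc.subtype_mk _) ?_
  rintro ⟨z, c, hc, hcz⟩
  have h1 : D.δ c (o x) = cs.simple i * g := (hFsub x hc.2).trans hg.symm
  have h2 : D.δ z (o x) = g ∨ D.δ z (o x) = g * cs.simple k := by
    rw [hgk, ← hg]
    rcases left_cases h1 hcz with h2 | h2
    · exact Or.inr h2
    · left; rw [h2, cs.simple_mul_simple_cancel_left]
  obtain ⟨y, hy, hyg, -⟩ := existsUnique_right hlk h2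
  exact ⟨(⟨c, hc⟩, ⟨y, hy⟩), Subtype.ext (hfu (⟨c, hc⟩, ⟨y, hy⟩) z hcz
    (congrArg cs.length hyg).le).symm⟩

theorem ClosedAdj.secondCountableTopology_of_panels (hD : D.ClosedAdj) [Finite W]
    (hp : ∀ i c, SecondCountableTopology (D.panel i c)) : SecondCountableTopology C := by
  rcases isEmpty_or_nonempty C with hC | ⟨⟨c⟩⟩
  · infer_instance
  obtain ⟨n, hn⟩ := D.exists_ball_eq_univ c
  suffices H : ∀ n, SecondCountableTopology {d | cs.length (D.δ c d) ≤ n} by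
    have h1 := H n
    rw [hn] at h1
    exact (Homeomorph.Set.univ C).symm.isEmbedding.secondCountableTopology
  intro n
  induction n with
  | zero =>
    rw [ball_zero]
    infer_instance
  | succ n ih =>
    have hcl : IsClosed {d | cs.length (D.δ c d) ≤ n} :=
      hD.isClosed_length_le n continuous_const continuous_id
    have hU := secondCountableTopology_iUnion
      (K := fun o : Option B => o.elim {d | cs.length (D.δ c d) ≤ n}
        fun i => {d | ∃ z ∈ {z | cs.length (D.δ c z) ≤ n}, D.Adj i z d})
      (fun o => by
        cases o with
        | none => exact hcl.isCompact
        | some i => exact (hD.isClosed_exists_adj hcl i).isCompact)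
      (fun o => by
        cases o with
        | none => exact ih
        | some i => exact hD.secondCountableTopology_exists_adj hp hcl ih i)
    rw [iUnion_option] at hU
    rw [ball_succ]
    exact hU

/-- An infinite totally disconnected compact building is homeomorphic to the Cantor set. -/
theorem ClosedAdj.nonempty_homeomorph_cantorSet (hD : D.ClosedAdj) [Finite W] [Nontrivial B]
    (hirr : cs.IsIrreducible) [TotallyDisconnectedSpace C] [Infinite C] :
    Nonempty (C ≃ₜ cantorSet) := by
  obtain ⟨i, c, hic⟩ : ∃ i c, (D.panel i c).Infinite := by
    by_contra! h
    have := finite_of_panels (D := D) fun i c => h i c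
    exact not_finite C
  have hacc := hD.isCountableAccPt_of_infinite hirr hic
  have hsc : SecondCountableTopology C := hD.secondCountableTopology_of_panels fun i c => by
    obtain ⟨j, hij⟩ := hirr.exists_not_commute i
    obtain ⟨i', j', w, u, t, v, r, q, p, n, h⟩ := cs.exists_rankTwo hij
    exact hD.secondCountableTopology_panel h (hacc i) c
  obtain ⟨e⟩ := nonempty_homeomorph_nat_bool (X := C) fun x hx => by
    obtain ⟨S, -, hS, hcl⟩ := hacc i x
    obtain ⟨_, rfl, y, hy, hyx⟩ := mem_closure_iff.mp hcl {x} hx rfl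
    exact hS y hy hyx
  exact ⟨e.trans cantorSetHomeomorphNatToBool.symm⟩

end WeylDistance

/-! ### From buildings to Weyl distances: charts of apartments. -/

namespace CoxeterSystem

variable {B W : Type*} [Group W] {M : CoxeterMatrix B} (cs : CoxeterSystem M W)

theorem parabolic_empty : cs.parabolic ∅ = ⊥ := by
  simp [parabolic]

theorem mem_parabolic_singleton_iff {i : B} {w : W} :
    w ∈ cs.parabolic {i} ↔ w = 1 ∨ w = cs.simple i := by
  rw [parabolic, Set.image_singleton, Subgroup.mem_closure_singleton]
  constructor
  · rintro ⟨n, rfl⟩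
    obtain ⟨k, rfl | rfl⟩ := n.even_or_odd'
    · left
      rw [zpow_mul, zpow_ofNat, cs.simple_sq, one_zpow]
    · right
      rw [zpow_add_one, zpow_mul, zpow_ofNat, cs.simple_sq, one_zpow, one_mul]
  · rintro (rfl | rfl)
    · exact ⟨0, zpow_zero _⟩
    · exact ⟨1, zpow_one _⟩

/-- The simplex `w W_J` of the Coxeter complex. -/
def coset (w : W) (J : Set B) : cs.CoxeterComplex :=
  ⟨w • (cs.parabolic J : Set W), w, J, rfl⟩

theorem mem_coset_iff {w x : W} {J : Set B} : x ∈ (cs.coset w J).1 ↔ w⁻¹ * x ∈ cs.parabolic J :=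
  mem_leftCoset_iff w

theorem coset_empty (w : W) : (cs.coset w ∅).1 = {w} := by
  ext x
  rw [mem_coset_iff, parabolic_empty, Subgroup.mem_bot, Set.mem_singleton_iff, inv_mul_eq_one,
    eq_comm]

end CoxeterSystem

namespace ThickBuilding

open Set

variable {B W V : Type*} [Group W] {M : CoxeterMatrix B} {cs : CoxeterSystem M W}

/-- A type preserving isomorphism of an apartment with the Coxeter complex. -/
structure Chart (Δ : ThickBuilding cs V) (A : Set (Finset V)) where
  mem : A ∈ Δ.apartments
  e : A ≃ cs.CoxeterComplex
  le_iff : ∀ a b : A, a.1 ⊆ b.1 ↔ (e b).1 ⊆ (e a).1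
  typ_eq : ∀ (a : A) (w : W) (J : Set B),
    (e a).1 = w • (cs.parabolic J : Set W) → Δ.typ '' (a.1 : Set V) = Jᶜ

variable {Δ : ThickBuilding cs V} {A A' : Set (Finset V)} {a b c d : Finset V} {w w' : W} {i : B}

theorem nonempty_chart (hA : A ∈ Δ.apartments) : Nonempty (Δ.Chart A) := by
  obtain ⟨e, h1, h2⟩ := Δ.apartment_iso A hA
  exact ⟨⟨hA, e, h1, h2⟩⟩

namespace Chart

variable (κ : Δ.Chart A)

/-- The face of type `Jᶜ` of the chamber with a given coordinate. -/
def face (w : W) (J : Set B) : Finset V := (κ.e.symm (cs.coset w J)).1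

/-- The chamber of an apartment with a given coordinate. -/
def chamber (w : W) : Finset V := κ.face w ∅

theorem face_mem (w : W) (J : Set B) : κ.face w J ∈ A := (κ.e.symm (cs.coset w J)).2

theorem chamber_mem (w : W) : κ.chamber w ∈ A := κ.face_mem w ∅

theorem e_face (w : W) (J : Set B) : κ.e ⟨κ.face w J, κ.face_mem w J⟩ = cs.coset w J :=
  κ.e.apply_symm_apply _

theorem subset_chamber_iff (ha : a ∈ A) : a ⊆ κ.chamber w ↔ w ∈ (κ.e ⟨a, ha⟩).1 := by
  rw [κ.le_iff ⟨a, ha⟩ ⟨κ.chamber w, κ.chamber_mem w⟩]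
  have : κ.e ⟨κ.chamber w, κ.chamber_mem w⟩ = cs.coset w ∅ := κ.e_face w ∅
  rw [this, cs.coset_empty, singleton_subset_iff]

theorem mem_of_subset (h : a ⊆ κ.chamber w) : a ∈ A :=
  Δ.apartment_down_closed A κ.mem a _ h (κ.chamber_mem w)

theorem typ_face (w : W) (J : Set B) : Δ.typ '' (κ.face w J : Set V) = Jᶜ :=
  κ.typ_eq ⟨κ.face w J, κ.face_mem w J⟩ w J (by rw [κ.e_face]; rfl)

theorem eq_face (h : a ⊆ κ.chamber w) : a = κ.face w (Δ.typ '' (a : Set V))ᶜ := by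
  have ha := κ.mem_of_subset h
  rw [κ.subset_chamber_iff ha] at h
  obtain ⟨x, J, hJ⟩ := (κ.e ⟨a, ha⟩).2
  rw [κ.typ_eq ⟨a, ha⟩ x J hJ, compl_compl]
  have h1 : κ.e ⟨a, ha⟩ = cs.coset w J := by
    refine Subtype.ext (hJ.trans ((leftCoset_eq_iff _).mpr ?_))
    rw [hJ] at h
    exact (mem_leftCoset_iff x).mp h
  rw [face, ← h1, Equiv.symm_apply_apply]

theorem exists_subset_chamber (ha : a ∈ A) : ∃ w, a ⊆ κ.chamber w := by
  obtain ⟨x, J, hJ⟩ := (κ.e ⟨a, ha⟩).2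
  refine ⟨x, (κ.subset_chamber_iff ha).mpr ?_⟩
  rw [hJ]
  exact (mem_leftCoset_iff x).mpr (by simp)

theorem face_subset_chamber_iff {J : Set B} :
    κ.face w J ⊆ κ.chamber w' ↔ w⁻¹ * w' ∈ cs.parabolic J := by
  rw [κ.subset_chamber_iff (κ.face_mem w J), κ.e_face, cs.mem_coset_iff]

theorem typ_chamber (w : W) : Δ.typ '' (κ.chamber w : Set V) = univ := by
  rw [chamber, typ_face, compl_empty]

theorem eq_chamber (ha : a ⊆ κ.chamber w) (h : Δ.typ '' (a : Set V) = univ) : a = κ.chamber w := by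
  rw [κ.eq_face ha, h, compl_univ, chamber]

theorem chamber_injective : Function.Injective κ.chamber := by
  intro w w' h
  have h1 : κ.face w ∅ ⊆ κ.chamber w' := h.subset
  rw [face_subset_chamber_iff, cs.parabolic_empty, Subgroup.mem_bot, inv_mul_eq_one] at h1
  exact h1

end Chart

theorem exists_chart (ha : a ∈ Δ.simplices) (hb : b ∈ Δ.simplices) :
    ∃ A, ∃ _ : Δ.Chart A, a ∈ A ∧ b ∈ A := by
  obtain ⟨A, hA, h1, h2⟩ := Δ.exists_apartment a ha b hb
  obtain ⟨κ⟩ := nonempty_chart hA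
  exact ⟨A, κ, h1, h2⟩

theorem isChamber_iff : Δ.IsChamber c ↔ c ∈ Δ.simplices ∧ Δ.typ '' (c : Set V) = univ := by
  constructor
  · intro hc
    refine ⟨hc.prop, ?_⟩
    obtain ⟨A, κ, hcA, -⟩ := exists_chart hc.prop hc.prop
    obtain ⟨w, hw⟩ := κ.exists_subset_chamber hcA
    rw [Maximal.eq_of_le (P := (· ∈ Δ.simplices)) hc
      (Δ.apartment_subset A κ.mem (κ.chamber_mem w)) hw]
    exact κ.typ_chamber w
  · rintro ⟨hc, htyp⟩
    refine ⟨hc, fun d hd hcd => ?_⟩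
    obtain ⟨A, κ, hdA, -⟩ := exists_chart hd hd
    obtain ⟨w, hw⟩ := κ.exists_subset_chamber hdA
    rw [κ.eq_chamber (hcd.trans hw) htyp]
    exact hw

theorem IsChamber.typ_eq (hc : Δ.IsChamber c) : Δ.typ '' (c : Set V) = univ :=
  (isChamber_iff.mp hc).2

namespace Chart

variable (κ : Δ.Chart A)

theorem isChamber (w : W) : Δ.IsChamber (κ.chamber w) :=
  isChamber_iff.mpr ⟨Δ.apartment_subset A κ.mem (κ.chamber_mem w), κ.typ_chamber w⟩

theorem exists_chamber_eq (hc : Δ.IsChamber c) (h : c ∈ A) : ∃ w, κ.chamber w = c := by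
  obtain ⟨w, hw⟩ := κ.exists_subset_chamber h
  exact ⟨w, (κ.eq_chamber hw hc.typ_eq).symm⟩

end Chart

/-- Two chambers are `i`-adjacent if they have a common face of type `{i}ᶜ`. -/
def Adj (Δ : ThickBuilding cs V) (i : B) (c d : Finset V) : Prop :=
  ∃ a : Finset V, Δ.typ '' (a : Set V) = {i}ᶜ ∧ a ⊆ c ∧ a ⊆ d

namespace Chart

variable (κ : Δ.Chart A)

theorem adj_iff : Δ.Adj i (κ.chamber w) (κ.chamber w') ↔ w' = w ∨ w' = w * cs.simple i := by
  have key : w⁻¹ * w' ∈ cs.parabolic {i} ↔ w' = w ∨ w' = w * cs.simple i := by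
    rw [cs.mem_parabolic_singleton_iff, inv_mul_eq_iff_eq_mul, inv_mul_eq_iff_eq_mul, mul_one]
  constructor
  · rintro ⟨a, ha, h1, h2⟩
    rw [κ.eq_face h1, ha, compl_compl, κ.face_subset_chamber_iff] at h2
    exact key.mp h2
  · intro h
    refine ⟨κ.face w {i}, κ.typ_face w {i}, κ.face_subset_chamber_iff.mpr ?_,
      κ.face_subset_chamber_iff.mpr (key.mpr h)⟩
    simp

/-- The change of coordinates is injective and preserves i-adjacency, so it commutes with right
multiplication by every simple reflection and is a left translation. -/
theorem exists_translation (κ κ' : Δ.Chart A) : ∃ g, ∀ w, κ'.chamber w = κ.chamber (g * w) := by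
  choose σ hσ using fun w => κ.exists_chamber_eq (κ'.isChamber w) (κ'.chamber_mem w)
  refine ⟨σ 1, fun w => ?_⟩
  rw [← hσ w]
  congr 1
  induction w using cs.simple_induction_right with
  | one => rw [mul_one]
  | mul_simple_right w i ih =>
    have h1 : Δ.Adj i (κ'.chamber w) (κ'.chamber (w * cs.simple i)) := κ'.adj_iff.mpr (Or.inr rfl)
    rw [← hσ, ← hσ, κ.adj_iff] at h1
    rcases h1 with h1 | h1
    · have h2 := κ'.chamber_injective ((hσ _).symm.trans ((congrArg κ.chamber h1).trans (hσ w)))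
      have h3 := (cs.length_eq_zero_iff (w := cs.simple i)).mpr (mul_eq_left.mp h2)
      rw [cs.length_simple] at h3
      exact absurd h3 one_ne_zero
    · rw [h1, ih, mul_assoc]

/-- A chart can be moved to another apartment, fixing two common simplices. -/
theorem exists_transfer (κ : Δ.Chart A) (hA' : A' ∈ Δ.apartments) (ha : a ∈ A) (hb : b ∈ A)
    (ha' : a ∈ A') (hb' : b ∈ A') : ∃ κ' : Δ.Chart A', ∀ w,
      (a ⊆ κ.chamber w → a ⊆ κ'.chamber w) ∧ (b ⊆ κ.chamber w → b ⊆ κ'.chamber w) := by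
  obtain ⟨E, hle, htyp, hEa, hEb⟩ := Δ.exists_iso A κ.mem A' hA' a b ha hb ha' hb'
  let κ' : Δ.Chart A' :=
    { mem := hA'
      e := E.symm.trans κ.e
      le_iff := fun x y => by
        rw [Equiv.trans_apply, Equiv.trans_apply, ← κ.le_iff, hle, E.apply_symm_apply,
          E.apply_symm_apply]
      typ_eq := fun x w J h => by
        rw [← κ.typ_eq _ w J h, ← htyp, E.apply_symm_apply] }
  have key : ∀ w, ∀ x (hx : x ∈ A), (E ⟨x, hx⟩).1 = x → x ⊆ κ.chamber w → x ⊆ κ'.chamber w := by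
    intro w x hx hE h
    have h1 : κ'.chamber w = (E ⟨κ.chamber w, κ.chamber_mem w⟩).1 := rfl
    have h2 := (hle ⟨x, hx⟩ ⟨κ.chamber w, κ.chamber_mem w⟩).mp h
    rwa [hE, ← h1] at h2
  exact ⟨κ', fun w => ⟨key w a ha (hEa _ rfl), key w b hb (hEb _ rfl)⟩⟩

/-- Coordinates of a chamber and a simplex in two charts are related by a translation. -/
theorem exists_translation_of_subset (κ : Δ.Chart A) (κ' : Δ.Chart A') {u v : W}
    (hw : κ.chamber w = κ'.chamber u) (ha : a ∈ A) (hv : a ⊆ κ'.chamber v) :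
    ∃ g, w = g * u ∧ a ⊆ κ.chamber (g * v) := by
  obtain ⟨κ'', h⟩ := κ'.exists_transfer κ.mem (a := κ'.chamber u) (κ'.chamber_mem u)
    (κ'.mem_of_subset hv) (hw ▸ κ.chamber_mem w) ha
  obtain ⟨g, hg⟩ := κ.exists_translation κ''
  refine ⟨g, κ.chamber_injective ?_, hg v ▸ (h v).2 hv⟩
  rw [← hg u, hw]
  exact κ''.eq_chamber ((h u).1 subset_rfl) (κ'.typ_chamber u)

end Chart

theorem IsChamber.eq_of_typ_eq (hc : Δ.IsChamber c) (ha : a ⊆ c) (hb : b ⊆ c)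
    (h : Δ.typ '' (a : Set V) = Δ.typ '' (b : Set V)) : a = b := by
  obtain ⟨A, κ, hcA, -⟩ := exists_chart hc.prop hc.prop
  obtain ⟨w, rfl⟩ := κ.exists_chamber_eq hc hcA
  rw [κ.eq_face ha, κ.eq_face hb, h]

theorem IsChamber.typ_injOn (hc : Δ.IsChamber c) : InjOn Δ.typ (c : Set V) := by
  intro u hu v hv h
  exact Finset.singleton_injective (hc.eq_of_typ_eq (a := {u}) (b := {v}) (by simpa using hu)
    (by simpa using hv) (by simp [h]))

theorem exists_weyl_distance (Δ : ThickBuilding cs V) : ∃ δ : Finset V → Finset V → W,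
    ∀ A, ∀ κ : Δ.Chart A, ∀ w w', δ (κ.chamber w) (κ.chamber w') = w⁻¹ * w' := by
  have h : ∀ c d, ∃ g : W, ∀ A, ∀ κ : Δ.Chart A, ∀ w w',
      κ.chamber w = c → κ.chamber w' = d → g = w⁻¹ * w' := by
    intro c d
    by_cases hcd : ∃ A, ∃ κ : Δ.Chart A, ∃ w w', κ.chamber w = c ∧ κ.chamber w' = d
    · obtain ⟨A, κ, w, w', rfl, rfl⟩ := hcd
      refine ⟨w⁻¹ * w', fun A' κ' u u' hu hu' => ?_⟩
      obtain ⟨g, rfl, h1⟩ := κ.exists_translation_of_subset κ' hu.symm (κ.chamber_mem w')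
        hu'.symm.subset
      rw [κ.chamber_injective (κ.eq_chamber h1 (κ.typ_chamber w'))]
      group
    · exact ⟨1, fun A κ w w' h1 h2 => (hcd ⟨A, κ, w, w', h1, h2⟩).elim⟩
  choose δ hδ using h
  exact ⟨δ, fun A κ w w' => hδ _ _ A κ w w' rfl rfl⟩

/-- The Weyl distance of two chambers. -/
noncomputable def weylDist (Δ : ThickBuilding cs V) : Finset V → Finset V → W :=
  Δ.exists_weyl_distance.choose

theorem weylDist_chamber (κ : Δ.Chart A) (w w' : W) :
    Δ.weylDist (κ.chamber w) (κ.chamber w') = w⁻¹ * w' :=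
  Δ.exists_weyl_distance.choose_spec A κ w w'

theorem IsChamber.exists_chart (hc : Δ.IsChamber c) (hd : Δ.IsChamber d) :
    ∃ A, ∃ κ : Δ.Chart A, ∃ w w', κ.chamber w = c ∧ κ.chamber w' = d := by
  obtain ⟨A, κ, h1, h2⟩ := ThickBuilding.exists_chart hc.prop hd.prop
  obtain ⟨w, hw⟩ := κ.exists_chamber_eq hc h1
  obtain ⟨w', hw'⟩ := κ.exists_chamber_eq hd h2
  exact ⟨A, κ, w, w', hw, hw'⟩

theorem IsChamber.adj_iff (hc : Δ.IsChamber c) (hd : Δ.IsChamber d) :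
    Δ.Adj i c d ↔ c = d ∨ Δ.weylDist c d = cs.simple i := by
  obtain ⟨A, κ, w, w', rfl, rfl⟩ := hc.exists_chart hd
  rw [κ.adj_iff, weylDist_chamber, κ.chamber_injective.eq_iff, inv_mul_eq_iff_eq_mul, eq_comm]

theorem IsChamber.exists_face (hc : Δ.IsChamber c) (i : B) :
    ∃ a, a ⊆ c ∧ Δ.typ '' (a : Set V) = {i}ᶜ := by
  obtain ⟨A, κ, w, -, rfl, -⟩ := hc.exists_chart hc
  exact ⟨κ.face w {i}, κ.face_subset_chamber_iff.mpr (by simp), κ.typ_face w {i}⟩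

theorem IsChamber.weylDist_step (hc : Δ.IsChamber c) {x y : Finset V} (hx : Δ.IsChamber x)
    (hy : Δ.IsChamber y) (h : Δ.Adj i x y) : Δ.weylDist c y = Δ.weylDist c x ∨
      Δ.weylDist c y = Δ.weylDist c x * cs.simple i := by
  obtain ⟨a, hat, hax, hay⟩ := h
  obtain ⟨A, κ, w, v, rfl, rfl⟩ := hc.exists_chart hx
  obtain ⟨A', κ', w', v', hw, rfl⟩ := hc.exists_chart hy
  -- The chamber y need not lie in the apartment of c and x, but the chamber with its transported
  -- coordinate does, has the same distance from c, and still contains the common face a.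
  obtain ⟨g, rfl, hg⟩ := κ.exists_translation_of_subset κ' hw.symm (κ.mem_of_subset hax) hay
  have h1 : Δ.Adj i (κ.chamber v) (κ.chamber (g * v')) := ⟨a, hat, hax, hg⟩
  rw [← hw, weylDist_chamber, hw, weylDist_chamber]
  rw [κ.adj_iff] at h1
  rcases h1 with h1 | h1
  · left
    rw [← h1]
    group
  · right
    rw [mul_assoc, ← h1]
    group

theorem IsChamber.exists_ne_ne (hc : Δ.IsChamber c) (i : B) : ∃ x y, Δ.IsChamber x ∧
    Δ.IsChamber y ∧ x ≠ y ∧ Δ.weylDist c x = cs.simple i ∧ Δ.weylDist c y = cs.simple i := by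
  obtain ⟨a, hac, hat⟩ := hc.exists_face i
  have ha : a ∈ Δ.simplices := Δ.down_closed a c hac hc.prop
  have hna : ¬ Maximal (· ∈ Δ.simplices) a := fun h => by
    have h1 := IsChamber.typ_eq (Δ := Δ) h
    rw [hat] at h1
    exact (h1 ▸ mem_univ i : i ∈ ({i}ᶜ : Set B)) rfl
  have h3 := Δ.thick a ha hna
  have h2 : 2 ≤ ({c : Finset V | Maximal (· ∈ Δ.simplices) c ∧ a ⊆ c} \ {c}).encard := by
    rw [← encard_sdiff_singleton_add_one
      (show c ∈ {c : Finset V | Maximal (· ∈ Δ.simplices) c ∧ a ⊆ c} from ⟨hc, hac⟩),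
      show (3 : ℕ∞) = 2 + 1 by norm_num] at h3
    exact (ENat.add_le_add_iff_right ENat.one_ne_top).mp h3
  obtain ⟨x, hx, y, hy, hxy⟩ := one_lt_encard_iff_nontrivial.mp
    (lt_of_lt_of_le (by norm_num) h2)
  have key : ∀ z ∈ {c : Finset V | Maximal (· ∈ Δ.simplices) c ∧ a ⊆ c} \ {c},
      Δ.weylDist c z = cs.simple i := fun z hz =>
    ((hc.adj_iff hz.1.1).mp ⟨a, hat, hac, hz.1.2⟩).resolve_left fun h => hz.2 h.symm
  exact ⟨x, y, hx.1.1, hy.1.1, hxy, key x hx, key y hy⟩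

end ThickBuilding

/-! ### The Weyl distance on tuples of vertices. -/

namespace ThickBuilding

open Set

variable {B W V : Type*} [Group W] {M : CoxeterMatrix B} {cs : CoxeterSystem M W}
  {Δ : ThickBuilding cs V} {c d x y : Finset V} {i : B}

theorem IsChamber.weylDist_eq_one_iff (hc : Δ.IsChamber c) (hd : Δ.IsChamber d) :
    Δ.weylDist c d = 1 ↔ c = d := by
  obtain ⟨A, κ, w, w', rfl, rfl⟩ := hc.exists_chart hd
  rw [weylDist_chamber, inv_mul_eq_one, κ.chamber_injective.eq_iff]

theorem IsChamber.weylDist_inv (hc : Δ.IsChamber c) (hd : Δ.IsChamber d) :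
    Δ.weylDist d c = (Δ.weylDist c d)⁻¹ := by
  obtain ⟨A, κ, w, w', rfl, rfl⟩ := hc.exists_chart hd
  rw [weylDist_chamber, weylDist_chamber, mul_inv_rev, inv_inv]

theorem IsChamber.exists_weylDist_eq_mul (hc : Δ.IsChamber c) (hd : Δ.IsChamber d) (i : B) :
    ∃ e, Δ.IsChamber e ∧ Δ.weylDist d e = cs.simple i ∧
      Δ.weylDist c e = Δ.weylDist c d * cs.simple i := by
  obtain ⟨A, κ, w, w', rfl, rfl⟩ := hc.exists_chart hd
  refine ⟨κ.chamber (w' * cs.simple i), κ.isChamber _, ?_, ?_⟩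
  · rw [weylDist_chamber, inv_mul_cancel_left]
  · rw [weylDist_chamber, weylDist_chamber, mul_assoc]

/-- The Weyl distance from a fixed chamber differs from the one from another chamber by an element
that is no longer than a path. -/
theorem IsChamber.exists_weylDist_eq_mul_of_length (hc : Δ.IsChamber c) (hx : Δ.IsChamber x)
    (hy : Δ.IsChamber y) : ∃ h, cs.length h ≤ cs.length (Δ.weylDist c y) ∧
      Δ.weylDist x y = Δ.weylDist x c * h := by
  induction hn : cs.length (Δ.weylDist c y) generalizing y with
  | zero =>
    rw [cs.length_eq_zero_iff, hc.weylDist_eq_one_iff hy] at hn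
    exact ⟨1, by rw [cs.length_one], by rw [hn, mul_one]⟩
  | succ n ih =>
    have hne : Δ.weylDist c y ≠ 1 := by
      intro h
      rw [h, cs.length_one] at hn
      omega
    obtain ⟨i, hi⟩ := cs.exists_rightDescent_of_ne_one hne
    obtain ⟨z, hz, hyz, hcz⟩ := hc.exists_weylDist_eq_mul hy i
    have hl := cs.isRightDescent_iff.mp hi
    obtain ⟨h, hhn, hh⟩ := ih hz (by rw [hcz]; omega)
    have hzy : Δ.Adj i z y := (hz.adj_iff hy).mpr
      (Or.inr (by rw [hy.weylDist_inv hz, hyz, cs.inv_simple]))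
    rcases hx.weylDist_step hz hy hzy with h1 | h1
    · exact ⟨h, by omega, h1.trans hh⟩
    · refine ⟨h * cs.simple i, ?_, by rw [h1, hh, mul_assoc]⟩
      have := cs.length_mul_simple h i
      omega

/-- If x and y had the same distance f from c, then δ(x, y) = f⁻¹ h with h no longer than f. But h
would be f times the reflection, which is longer. -/
theorem IsChamber.weylDist_step_up (hc : Δ.IsChamber c) (hx : Δ.IsChamber x) (hy : Δ.IsChamber y)
    (h : Δ.weylDist x y = cs.simple i)
    (hl : cs.length (Δ.weylDist c x) < cs.length (Δ.weylDist c x * cs.simple i)) :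
    Δ.weylDist c y = Δ.weylDist c x * cs.simple i := by
  refine (hc.weylDist_step hx hy ((hx.adj_iff hy).mpr (Or.inr h))).resolve_left fun h1 => ?_
  obtain ⟨g, hg, hxy⟩ := hc.exists_weylDist_eq_mul_of_length hx hy
  rw [h, hc.weylDist_inv hx, eq_inv_mul_iff_mul_eq] at hxy
  rw [hxy, ← h1] at hl
  omega

/-- The chamber with a given tuple of vertices. -/
noncomputable def toChamber (x : Δ.chamberSet) : Finset V := x.2.choose

theorem isChamber_toChamber (x : Δ.chamberSet) : Δ.IsChamber (toChamber x) := x.2.choose_spec.1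

theorem coe_toChamber (x : Δ.chamberSet) :
    (toChamber x : Set V) = range fun i => (x.1 i).1 := x.2.choose_spec.2

theorem mem_toChamber_iff {x : Δ.chamberSet} {v : V} :
    v ∈ toChamber x ↔ v = (x.1 (Δ.typ v)).1 := by
  rw [← Finset.mem_coe, coe_toChamber]
  constructor
  · rintro ⟨i, rfl⟩
    have := (x.1 i).2
    simp only at this ⊢
    rw [this]
  · intro h
    exact ⟨_, h.symm⟩

theorem toChamber_injective : Function.Injective (toChamber (Δ := Δ)) := by
  intro x y h
  refine Subtype.ext (funext fun i => Subtype.ext ?_)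
  have h1 : (x.1 i).1 ∈ toChamber x := by
    rw [← Finset.mem_coe, coe_toChamber]
    exact mem_range_self i
  rw [h, mem_toChamber_iff] at h1
  rw [h1, (x.1 i).2]

theorem IsChamber.exists_toChamber_eq (hc : Δ.IsChamber c) :
    ∃ x : Δ.chamberSet, toChamber x = c := by
  have h : ∀ i, ∃ v ∈ (c : Set V), Δ.typ v = i := fun i =>
    (hc.typ_eq ▸ mem_univ i : i ∈ Δ.typ '' (c : Set V))
  choose f hf hfi using h
  have hr : (c : Set V) = range f := by
    ext v
    constructor
    · intro hv
      exact ⟨Δ.typ v, hc.typ_injOn (hf _) hv (hfi _)⟩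
    · rintro ⟨i, rfl⟩
      exact hf i
  refine ⟨⟨fun i => ⟨f i, hfi i⟩, c, hc, hr⟩, Finset.coe_injective ?_⟩
  exact (coe_toChamber _).trans hr.symm

theorem adj_toChamber_iff {x y : Δ.chamberSet} :
    Δ.Adj i (toChamber x) (toChamber y) ↔ ∀ j, j ≠ i → x.1 j = y.1 j := by
  classical
  constructor
  · rintro ⟨a, hat, hax, hay⟩ j hj
    obtain ⟨v, hv, rfl⟩ : j ∈ Δ.typ '' (a : Set V) := hat ▸ hj
    exact Subtype.ext ((mem_toChamber_iff.mp (hax hv)).symm.trans (mem_toChamber_iff.mp (hay hv)))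
  · intro h
    refine ⟨(toChamber x).filter fun v => Δ.typ v ≠ i, ?_, Finset.filter_subset _ _, ?_⟩
    · ext j
      constructor
      · rintro ⟨v, hv, rfl⟩
        exact (Finset.mem_filter.mp hv).2
      · intro hj
        obtain ⟨v, hv, rfl⟩ : j ∈ Δ.typ '' (toChamber x : Set V) :=
          (isChamber_toChamber x).typ_eq ▸ mem_univ j
        exact ⟨v, Finset.mem_filter.mpr ⟨hv, hj⟩, rfl⟩
    · intro v hv
      obtain ⟨h1, h2⟩ := Finset.mem_filter.mp hv
      rw [mem_toChamber_iff] at h1 ⊢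
      rwa [← h _ h2]

/-- The Weyl distance on the set of chambers of a building. -/
noncomputable def weylDistance (Δ : ThickBuilding cs V) : WeylDistance cs Δ.chamberSet where
  δ x y := Δ.weylDist (toChamber x) (toChamber y)
  eq_one_iff x y := by
    rw [(isChamber_toChamber x).weylDist_eq_one_iff (isChamber_toChamber y),
      toChamber_injective.eq_iff]
  inv x y := (isChamber_toChamber x).weylDist_inv (isChamber_toChamber y)
  step c x y i h := (isChamber_toChamber c).weylDist_step (isChamber_toChamber x)
    (isChamber_toChamber y)
    (((isChamber_toChamber x).adj_iff (isChamber_toChamber y)).mpr (Or.inr h))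
  step_up c x y i h hl := (isChamber_toChamber c).weylDist_step_up (isChamber_toChamber x)
    (isChamber_toChamber y) h hl
  exists_step c x i := by
    obtain ⟨e, he, h1, h2⟩ :=
      (isChamber_toChamber c).exists_weylDist_eq_mul (isChamber_toChamber x) i
    obtain ⟨y, rfl⟩ := he.exists_toChamber_eq
    exact ⟨y, h1, h2⟩
  thick x i := by
    obtain ⟨y, z, hy, hz, hne, h1, h2⟩ := (isChamber_toChamber x).exists_ne_ne i
    obtain ⟨y, rfl⟩ := hy.exists_toChamber_eq
    obtain ⟨z, rfl⟩ := hz.exists_toChamber_eq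
    exact ⟨y, z, fun h => hne (h ▸ rfl), h1, h2⟩

theorem adj_weylDistance_iff {x y : Δ.chamberSet} :
    Δ.weylDistance.Adj i x y ↔ ∀ j, j ≠ i → x.1 j = y.1 j := by
  rw [← adj_toChamber_iff, (isChamber_toChamber x).adj_iff (isChamber_toChamber y),
    toChamber_injective.eq_iff]
  rfl

theorem closedAdj [∀ i : B, TopologicalSpace (Δ.VertexOfType i)]
    [∀ i : B, T2Space (Δ.VertexOfType i)] : Δ.weylDistance.ClosedAdj := by
  intro i
  simp only [adj_weylDistance_iff, Set.ofPred_forall]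
  exact isClosed_iInter fun j => isClosed_iInter fun _ => isClosed_eq
    ((continuous_apply j).comp (continuous_subtype_val.comp continuous_fst))
    ((continuous_apply j).comp (continuous_subtype_val.comp continuous_snd))

theorem IsSpherical.finite (h : Δ.IsSpherical) : Finite W := by
  obtain ⟨A, κ, -⟩ := exists_chart Δ.empty_mem Δ.empty_mem
  have := (h A κ.mem).to_subtype
  exact Finite.of_injective (fun w => (⟨κ.chamber w, κ.chamber_mem w⟩ : A)) fun w w' hw =>
    κ.chamber_injective (congrArg Subtype.val hw)

theorem nonempty_chamberSet (Δ : ThickBuilding cs V) : Nonempty Δ.chamberSet := by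
  obtain ⟨A, κ, -⟩ := exists_chart Δ.empty_mem Δ.empty_mem
  obtain ⟨x, -⟩ := (κ.isChamber 1).exists_toChamber_eq
  exact ⟨x⟩

end ThickBuilding

/-! ### Conclusion. -/

theorem mainTheorem8 {B W V : Type*} [Fintype B] [Group W] {M : CoxeterMatrix B}
    (cs : CoxeterSystem M W) (Δ : ThickBuilding cs V)
    [∀ i : B, TopologicalSpace (Δ.VertexOfType i)]
    (hcompact : Δ.IsCompactSpherical) (hirr : cs.IsIrreducible) (hrank : 2 ≤ Fintype.card B) :
    Xor (ConnectedSpace Δ.chamberSet) (TotallyDisconnectedSpace Δ.chamberSet) ∧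
      (TotallyDisconnectedSpace Δ.chamberSet → Infinite Δ.chamberSet →
        Nonempty (Δ.chamberSet ≃ₜ cantorSet)) := by
  have hc := hcompact.compact
  have ht := hcompact.hausdorff
  have hcs : CompactSpace Δ.chamberSet :=
    isCompact_iff_compactSpace.mp hcompact.isClosed_chamberSet.isCompact
  have hW : Finite W := hcompact.spherical.finite
  have hB : Nontrivial B := Fintype.one_lt_card_iff_nontrivial.mp hrank
  have hD : Δ.weylDistance.ClosedAdj := Δ.closedAdj
  have hne := Δ.nonempty_chamberSet
  obtain ⟨x⟩ := hne
  obtain ⟨i⟩ := hB.to_nonempty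
  -- Thickness gives two distinct chambers, so the two alternatives exclude each other.
  obtain ⟨y, z, hyz, -⟩ := Δ.weylDistance.thick x i
  have hnot : ConnectedSpace Δ.chamberSet → ¬ TotallyDisconnectedSpace Δ.chamberSet := fun _ _ =>
    hyz (isPreconnected_univ.subsingleton (Set.mem_univ y) (Set.mem_univ z))
  refine ⟨?_, fun _ _ => hD.nonempty_homeomorph_cantorSet hirr⟩
  rcases hD.preconnected_or_totallyDisconnected hirr with h | h
  · have h' : ConnectedSpace Δ.chamberSet := { toNonempty := ⟨x⟩ }
    exact Or.inl ⟨h', hnot h'⟩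
  · exact Or.inr ⟨h, fun h' => hnot h' h⟩
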